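/- Let $(Y,\mathbf X)$ be a random pair with $Y\in\{1,\dots,h\}$ and $\mathbf X\in\mathbb R^p$, where $\mathbf X$ has finite fourth moments, $\Sigma=\mathrm{Var}(\mathbf X)$ is positive definite and $f_y=\Pr(Y=y)>0$ for every $y$. Put $\mathbf Z=\Sigma^{-1/2}(\mathbf X-E\mathbf X)$ (symmetric positive definite root). A subspace $S\subseteq\mathbb R^p$ is a dimension reduction subspace if $Y$ and $\mathbf Z$ are conditionally independent given $P_S\mathbf Z$, with $P_S$ the orthogonal projection onto $S$. Let $\mathcal S$ be the intersection of all dimension reduction subspaces, and assume that $\mathcal S$ is itself one (the central subspace exists). Let $\alpha_x$ be a $p\times r$ matrix of full column rank $r$, let $\alpha=\Sigma^{-1/2}\alpha_x(\alpha_x^T\Sigma^{-1}\alpha_x)^{-1/2}$ and $\mathcal H=\mathrm{Span}(\alpha)$, and assume the coordinate hypothesis $P_{\mathcal H}\mathcal S=\{0\}$. Assume - linearity: $E(\mathbf Z\mid P_{\mathcal S}\mathbf Z)=P_{\mathcal S}\mathbf Z$ almost surely; - coverage: $\mathrm{Span}\{E(\mathbf Z\mid Y=y):y=1,\dots,h\}=\mathcal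 S$; - constant covariance: $\mathrm{Var}(\mathbf Z\mid P_{\mathcal S}\mathbf Z)=I_p-P_{\mathcal S}$ almost surely. Let $g_y=\sqrt{f_y}$, $\mathbf g=(g_1,\dots,g_h)^T$, $D_g=\mathrm{diag}(g_1,\dots,g_h)$, $Q_g=I_h-\mathbf g\mathbf g^T$, and let $\mu$ be the $p\times h$ matrix with columns $g_yE(\mathbf Z\mid Y=y)$. Let $J_y$ be the indicator of $Y=y$, $\beta_y=\Sigma^{-1}\mathrm{Cov}(\mathbf X,J_y)$, $\varepsilon_y=J_y-f_y-\beta_y^T(\mathbf X-E\mathbf X)$, $\varepsilon=(\varepsilon_1,\dots,\varepsilon_h)^T$ and $$\Omega_{\mathcal H}=E\left(D_g^{-1}\varepsilon\varepsilon^TD_g^{-1}\otimes\alpha^T\mathbf Z\mathbf Z^T\alpha\right).$$ Let $(Y_i,\mathbf X_i)$, $i\ge1$, be i.i.d. copies of $(Y,\mathbf X)$. From the first $n$ of them form $\bar{\mathbf X}=\frac1n\sum_i\mathbf X_i$, $\hat\Sigma=\frac1n\sum_i(\mathbf X_i-\bar{\mathbf X})(\mathbf X_i-\bar{\mathbf X})^T$,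 $\hat{\mathbf Z}_i=\hat\Sigma^{-1/2}(\mathbf X_i-\bar{\mathbf X})$, $n_y=\#\{i:Y_i=y\}$, $\hat f_y=n_y/n$, $\bar{\mathbf Z}_y=n_y^{-1}\sum_{i:Y_i=y}\hat{\mathbf Z}_i$, $\hat M=\sum_y\hat f_y\bar{\mathbf Z}_y\bar{\mathbf Z}_y^T$, $\hat{\mathcal H}=\mathrm{Span}(\hat\Sigma^{-1/2}\alpha_x)$ and $T_n(\mathcal H)=n\,\mathrm{trace}(P_{\hat{\mathcal H}}\hat MP_{\hat{\mathcal H}})$. Then $$\Omega_{\mathcal H}=(Q_g-\mu^T\mu)\otimes I_r,$$ and, if $\delta_1\ge\dots\ge\delta_h$ are the eigenvalues of $Q_g-\mu^T\mu$ with multiplicity, then $\delta_h=0$ and, as $n\to\infty$, $$T_n(\mathcal H)\ \xrightarrow{\ \mathcal L\ }\ \sum_{j=1}^{h-1}\delta_j\,\chi^2_j(r),$$ where $\chi^2_1(r),\dots,\chi^2_{h-1}(r)$ are independent chi-squared random variables with $r$ degrees of freedom. -/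

import Mathlib

open MeasureTheory ProbabilityTheory Filter Topology
open scoped Matrix Kronecker MatrixOrder

noncomputable section

namespace SIR

/-- Possible values of one observation `(Y, X)`: a slice label in `{1, …, h}` (indexed by `Fin h`)
and a predictor vector in `ℝ^p`. -/
abbrev Obs (h p : ℕ) : Type := Fin h × EuclideanSpace ℝ (Fin p)

/-! ### Linear algebra -/

/-- `A^{-1/2}`: for a positive definite `A`, the symmetric positive definite square root of
`A⁻¹`. -/
def invSqrt {m : ℕ} (A : Matrix (Fin m) (Fin m) ℝ) : Matrix (Fin m) (Fin m) ℝ :=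
  CFC.sqrt A⁻¹

/-- The span of the columns of a matrix. -/
def colSpan {p r : ℕ} (A : Matrix (Fin p) (Fin r) ℝ) : Submodule ℝ (EuclideanSpace ℝ (Fin p)) :=
  Submodule.span ℝ (Set.range fun k : Fin r => WithLp.toLp 2 (A.col k))

/-- The matrix `P_S` of the orthogonal projection onto `S`. -/
def projMatrix {p : ℕ} (S : Submodule ℝ (EuclideanSpace ℝ (Fin p))) : Matrix (Fin p) (Fin p) ℝ :=
  Matrix.of fun i j => (S.starProjection (EuclideanSpace.single j (1 : ℝ))) i

/-- `α = S^{-1/2} α_x (α_xᵀ S⁻¹ α_x)^{-1/2}`, for a covariance matrix `S`. -/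
def orthBasis {p r : ℕ} (S : Matrix (Fin p) (Fin p) ℝ) (αx : Matrix (Fin p) (Fin r) ℝ) :
    Matrix (Fin p) (Fin r) ℝ :=
  invSqrt S * αx * invSqrt (αxᵀ * S⁻¹ * αx)

/-! ### Population quantities

Below `P` is the joint law of `(Y, X)`, so that `Y` and `X` are the two coordinate maps on
`Obs h p`. -/

/-- `E(X)`. -/
def meanX {h p : ℕ} (P : Measure (Obs h p)) : EuclideanSpace ℝ (Fin p) :=
  ∫ w, w.2 ∂P

/-- `Σ = Var(X)`. -/
def covX {h p : ℕ} (P : Measure (Obs h p)) : Matrix (Fin p) (Fin p) ℝ :=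
  Matrix.of fun i j => cov[fun w : Obs h p => w.2 i, fun w : Obs h p => w.2 j; P]

/-- The standardized predictor `Z = Σ^{-1/2} (X - E(X))`. -/
def Z {h p : ℕ} (P : Measure (Obs h p)) (w : Obs h p) : EuclideanSpace ℝ (Fin p) :=
  Matrix.toEuclideanCLM (𝕜 := ℝ) (invSqrt (covX P)) (w.2 - meanX P)

theorem measurable_Z {h p : ℕ} (P : Measure (Obs h p)) : Measurable (Z P) := by
  unfold Z
  fun_prop

/-- The projected predictor `P_S Z`. -/
def projZ {h p : ℕ} (P : Measure (Obs h p)) (S : Submodule ℝ (EuclideanSpace ℝ (Fin p)))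
    (w : Obs h p) : EuclideanSpace ℝ (Fin p) :=
  S.starProjection (Z P w)

theorem measurable_projZ {h p : ℕ} (P : Measure (Obs h p))
    (S : Submodule ℝ (EuclideanSpace ℝ (Fin p))) : Measurable (projZ P S) :=
  S.starProjection.measurable.comp (measurable_Z P)

/-- The σ-algebra generated by `P_S Z`. -/
abbrev sigmaProjZ {h p : ℕ} (P : Measure (Obs h p)) (S : Submodule ℝ (EuclideanSpace ℝ (Fin p))) :
    MeasurableSpace (Obs h p) :=
  MeasurableSpace.comap (projZ P S) inferInstance

theorem sigmaProjZ_le {h p : ℕ} (P : Measure (Obs h p))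
    (S : Submodule ℝ (EuclideanSpace ℝ (Fin p))) :
    sigmaProjZ P S ≤ (inferInstance : MeasurableSpace (Obs h p)) :=
  (measurable_projZ P S).comap_le

/-- `S` is a dimension reduction subspace for the regression of `Y` on `Z`: `Y` and `Z` are
conditionally independent given `P_S Z`. -/
def IsDimReduction {h p : ℕ} (P : Measure (Obs h p)) [IsFiniteMeasure P]
    (S : Submodule ℝ (EuclideanSpace ℝ (Fin p))) : Prop :=
  CondIndepFun (sigmaProjZ P S) (sigmaProjZ_le P S) (fun w : Obs h p => w.1) (Z P) P

/-- The intersection `S_{Y|Z}` of all dimension reduction subspaces. -/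
def centralSubspace {h p : ℕ} (P : Measure (Obs h p)) [IsFiniteMeasure P] :
    Submodule ℝ (EuclideanSpace ℝ (Fin p)) :=
  sInf {S | IsDimReduction P S}

/-- The central subspace exists: the intersection of all dimension reduction subspaces is itself
a dimension reduction subspace. -/
def CentralSubspaceExists {h p : ℕ} (P : Measure (Obs h p)) [IsFiniteMeasure P] : Prop :=
  IsDimReduction P (centralSubspace P)

/-- `f_y = Pr(Y = y)`. -/
def f {h p : ℕ} (P : Measure (Obs h p)) (y : Fin h) : ℝ :=
  P.real {w | w.1 = y}

/-- `g_y = √f_y`. -/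
def g {h p : ℕ} (P : Measure (Obs h p)) (y : Fin h) : ℝ :=
  √(f P y)

/-- `E(Z | Y = y)`. -/
def condMeanZ {h p : ℕ} (P : Measure (Obs h p)) (y : Fin h) : EuclideanSpace ℝ (Fin p) :=
  ∫ w, Z P w ∂(P[|{w : Obs h p | w.1 = y}])

/-- Linearity condition: `E(Z | P_S Z) = P_S Z` for `S = S_{Y|Z}`. -/
def Linearity {h p : ℕ} (P : Measure (Obs h p)) [IsFiniteMeasure P] : Prop :=
  P[Z P | sigmaProjZ P (centralSubspace P)] =ᵐ[P] projZ P (centralSubspace P)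

/-- Coverage condition: `Span{E(Z | Y = y) : y = 1, …, h} = S_{Y|Z}`. -/
def Coverage {h p : ℕ} (P : Measure (Obs h p)) [IsFiniteMeasure P] : Prop :=
  Submodule.span ℝ (Set.range (condMeanZ P)) = centralSubspace P

/-- The `(i, j)` entry of the conditional covariance matrix `Var(Z | m)`. -/
def condCovZ {h p : ℕ} (P : Measure (Obs h p)) (m : MeasurableSpace (Obs h p)) (i j : Fin p) :
    Obs h p → ℝ :=
  P[fun w => (Z P w i - (P[Z P | m]) w i) * (Z P w j - (P[Z P | m]) w j) | m]

/-- Constant covariance condition: `Var(Z | P_S Z) = I_p - P_S` for `S = S_{Y|Z}`. -/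
def ConstantCovariance {h p : ℕ} (P : Measure (Obs h p)) [IsFiniteMeasure P] : Prop :=
  ∀ i j : Fin p, condCovZ P (sigmaProjZ P (centralSubspace P)) i j =ᵐ[P]
    fun _ => (1 - projMatrix (centralSubspace P)) i j

/-- Coordinate hypothesis `P_H S_{Y|Z} = {0}` with `H = Span(α)`,
`α = Σ^{-1/2} α_x (α_xᵀ Σ⁻¹ α_x)^{-1/2}`. -/
def CoordinateHypothesis {h p r : ℕ} (P : Measure (Obs h p)) [IsFiniteMeasure P]
    (αx : Matrix (Fin p) (Fin r) ℝ) : Prop :=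
  ∀ v ∈ centralSubspace P, (colSpan (orthBasis (covX P) αx)).starProjection v = 0

/-- The `p × h` matrix `μ` with columns `g_y E(Z | Y = y)`. -/
def muMatrix {h p : ℕ} (P : Measure (Obs h p)) : Matrix (Fin p) (Fin h) ℝ :=
  Matrix.of fun i y => g P y * condMeanZ P y i

/-- `Q_g = I_h - g gᵀ`. -/
def Qg {h p : ℕ} (P : Measure (Obs h p)) : Matrix (Fin h) (Fin h) ℝ :=
  1 - Matrix.vecMulVec (g P) (g P)

/-- The slice indicator `J_y`. -/
def J {h p : ℕ} (y : Fin h) (w : Obs h p) : ℝ :=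
  if w.1 = y then 1 else 0

/-- `β_y = Σ⁻¹ Cov(X, J_y)`. -/
def beta {h p : ℕ} (P : Measure (Obs h p)) (y : Fin h) : Fin p → ℝ :=
  (covX P)⁻¹ *ᵥ fun i => cov[fun w : Obs h p => w.2 i, J y; P]

/-- The population residuals `ε_y = J_y - f_y - β_yᵀ (X - E(X))`. -/
def eps {h p : ℕ} (P : Measure (Obs h p)) (w : Obs h p) (y : Fin h) : ℝ :=
  J y w - f P y - beta P y ⬝ᵥ (w.2 - meanX P).ofLp

/-- `Ω_H = E(D_g⁻¹ ε εᵀ D_g⁻¹ ⊗ αᵀ Z Zᵀ α)`, with entrywise expectation. -/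
def Omega {h p r : ℕ} (P : Measure (Obs h p)) (αx : Matrix (Fin p) (Fin r) ℝ) :
    Matrix (Fin h × Fin r) (Fin h × Fin r) ℝ :=
  Matrix.of fun a b => ∫ w,
    (((Matrix.diagonal (g P))⁻¹ * Matrix.vecMulVec (eps P w) (eps P w) *
        (Matrix.diagonal (g P))⁻¹) ⊗ₖ
      ((orthBasis (covX P) αx)ᵀ * Matrix.vecMulVec (Z P w).ofLp (Z P w).ofLp *
        orthBasis (covX P) αx)) a b ∂P

/-- `Q_g - μᵀ μ`. -/
def Delta {h p : ℕ} (P : Measure (Obs h p)) : Matrix (Fin h) (Fin h) ℝ :=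
  Qg P - (muMatrix P)ᵀ * muMatrix P

theorem isHermitian_Delta {h p : ℕ} (P : Measure (Obs h p)) : (Delta P).IsHermitian := by
  ext i j
  simp [Delta, Qg, Matrix.vecMulVec_apply, Matrix.mul_apply, Matrix.one_apply, mul_comm, eq_comm]

/-- `δ_1 ≥ … ≥ δ_h`: the eigenvalues of `Q_g - μᵀ μ`, with multiplicity, in decreasing order. -/
def delta {h p : ℕ} (P : Measure (Obs h p)) (j : Fin h) : ℝ :=
  (isHermitian_Delta P).eigenvalues₀ (Fin.cast (Fintype.card_fin h).symm j)

/-! ### Sample quantities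

Below `d : Fin n → Obs h p` is a data set of `n` observations `(Y_i, X_i)`. -/

/-- `n_y`, the number of observations in slice `y`. -/
def count {h p n : ℕ} (d : Fin n → Obs h p) (y : Fin h) : ℕ :=
  (Finset.univ.filter fun i => (d i).1 = y).card

/-- `f̂_y = n_y / n`. -/
def fHat {h p n : ℕ} (d : Fin n → Obs h p) (y : Fin h) : ℝ :=
  (count d y : ℝ) / n

/-- The sample mean of the `X_i`. -/
def meanHat {h p n : ℕ} (d : Fin n → Obs h p) : EuclideanSpace ℝ (Fin p) :=
  (n : ℝ)⁻¹ • ∑ i, (d i).2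

/-- The sample covariance matrix `Σ̂ = (1/n) ∑ (X_i - X̄)(X_i - X̄)ᵀ`. -/
def covHat {h p n : ℕ} (d : Fin n → Obs h p) : Matrix (Fin p) (Fin p) ℝ :=
  (n : ℝ)⁻¹ • ∑ i, Matrix.vecMulVec ((d i).2 - meanHat d).ofLp ((d i).2 - meanHat d).ofLp

/-- `Ẑ_i = Σ̂^{-1/2} (X_i - X̄)`. -/
def ZHat {h p n : ℕ} (d : Fin n → Obs h p) (i : Fin n) : EuclideanSpace ℝ (Fin p) :=
  Matrix.toEuclideanCLM (𝕜 := ℝ) (invSqrt (covHat d)) ((d i).2 - meanHat d)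

/-- `Z̄_y`, the average of the `Ẑ_i` in slice `y`. -/
def ZBar {h p n : ℕ} (d : Fin n → Obs h p) (y : Fin h) : EuclideanSpace ℝ (Fin p) :=
  (count d y : ℝ)⁻¹ • ∑ i with (d i).1 = y, ZHat d i

/-- `M̂ = ∑_y f̂_y Z̄_y Z̄_yᵀ`. -/
def MHat {h p n : ℕ} (d : Fin n → Obs h p) : Matrix (Fin p) (Fin p) ℝ :=
  ∑ y, fHat d y • Matrix.vecMulVec (ZBar d y).ofLp (ZBar d y).ofLp

/-- The orthogonal projection matrix onto `Ĥ = Span(Σ̂^{-1/2} α_x)`. -/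
def projHat {h p n r : ℕ} (αx : Matrix (Fin p) (Fin r) ℝ) (d : Fin n → Obs h p) :
    Matrix (Fin p) (Fin p) ℝ :=
  projMatrix (colSpan (invSqrt (covHat d) * αx))

/-- The test statistic `T_n(H) = n trace(P_Ĥ M̂ P_Ĥ)`. -/
def testStat {h p n r : ℕ} (αx : Matrix (Fin p) (Fin r) ℝ) (d : Fin n → Obs h p) : ℝ :=
  n * (projHat αx d * MHat d * projHat αx d).trace

/-! ### Chi-squared laws -/

/-- The chi-squared law with `k` degrees of freedom: the law of the sum of the squares of `k`
independent standard normal variables. -/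
def chiSquared (k : ℕ) : Measure ℝ :=
  (Measure.pi fun _ : Fin k => gaussianReal 0 1).map fun x => ∑ i, x i ^ 2

instance isProbabilityMeasure_chiSquared (k : ℕ) : IsProbabilityMeasure (chiSquared k) :=
  Measure.isProbabilityMeasure_map (Measurable.aemeasurable (by fun_prop))

end SIR

end

noncomputable section

namespace SIR

/-! ### Linear algebra -/

/-! Let `u_y` be the sample covariance of `X` and `J_y`, and `K(S) = S⁻¹ α_x (α_xᵀ S⁻¹ α_x)⁻¹ α_xᵀ
S⁻¹`. The root `Σ̂^{-1/2}` cancels from the statistic: `T_n = n ∑_y f̂_y⁻¹ u_yᵀ K(Σ̂) u_y`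
(`testStat_eq_sum`). Coverage and the coordinate hypothesis give `α_xᵀ β_y = 0`
(`transpose_mulVec_beta`), and then `K(Σ̂)` does not see the vector `Σ̂ β_y`. So `u_y` may be
replaced by `u_y - Σ̂ β_y` exactly, with no expansion of `Σ̂^{-1/2}` (`coefForm_sub_mulVec`). This
difference is the average of `(X - E X) ε_y` minus `(X̄ - E X)` times the average of `ε_y`
(`sliceSum_sub_mulVec_beta`). Hence `T_n` is a fixed continuous function of a normalized i.i.d. sum
and of consistent estimators. The central limit theorem, Slutsky and continuous mapping give the
limit `‖G‖²`, where `G` is centered Gaussian with the second moments of `D_g⁻¹ ε ⊗ αᵀ Z`, that is,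
with covariance `Ω_H`. To compute `Ω_H`, work slice by slice. On `{Y = c}`, coverage makes `ε_y` a
function of `P_S Z`. Since `αᵀ` kills `S`, `αᵀ Z = αᵀ (Z - P_S Z)`, so linearity and constant
covariance give `E(αᵀ Z Zᵀ α | P_S Z) = I`. Conditional independence of `Y` and `Z` then separates
the two factors (`integral_eps_mul_eps_mul_alphaZ`), and `E(ε εᵀ) = D_g (Q_g - μᵀ μ) D_g`
(`integral_eps_mul_eps`). Diagonalizing `Q_g - μᵀ μ` turns `‖G‖²` into the weighted chi-squared sum.
The last weight vanishes because `g` is in the kernel (`Delta_mulVec_g`). -/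

theorem invSqrt_mul_self {m : ℕ} {A : Matrix (Fin m) (Fin m) ℝ} (hA : A.PosSemidef) :
    invSqrt A * invSqrt A = A⁻¹ :=
  CFC.sqrt_mul_sqrt_self _ hA.inv.nonneg

theorem transpose_invSqrt {m : ℕ} (A : Matrix (Fin m) (Fin m) ℝ) :
    (invSqrt A)ᵀ = invSqrt A := by
  have h : (invSqrt A).IsHermitian := (CFC.sqrt_nonneg A⁻¹).isSelfAdjoint
  simpa [Matrix.IsHermitian, Matrix.conjTranspose_eq_transpose_of_trivial] using h

/-- The inverse of a singular matrix is `0` by convention. This keeps the algebraic identities for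
the statistic valid for every sample, including those with singular `Σ̂`. -/
theorem invSqrt_eq_zero {m : ℕ} {A : Matrix (Fin m) (Fin m) ℝ} (hA : ¬ IsUnit A) :
    invSqrt A = 0 := by
  rw [Matrix.isUnit_iff_isUnit_det] at hA
  simp [invSqrt, Matrix.nonsing_inv_apply_not_isUnit A hA]

theorem posDef_of_isUnit {m : ℕ} {A : Matrix (Fin m) (Fin m) ℝ} (hA : A.PosSemidef)
    (hu : IsUnit A) : A.PosDef :=
  hA.posDef_iff_isUnit.2 hu

theorem mulVec_injective_of_linearIndependent_col {p r : ℕ} {αx : Matrix (Fin p) (Fin r) ℝ}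
    (hαx : LinearIndependent ℝ αx.col) : Function.Injective αx.mulVec :=
  Matrix.mulVec_injective_iff.2 hαx

theorem posDef_transpose_mul_inv_mul {p r : ℕ} {S : Matrix (Fin p) (Fin p) ℝ} (hS : S.PosDef)
    {αx : Matrix (Fin p) (Fin r) ℝ} (hαx : LinearIndependent ℝ αx.col) :
    (αxᵀ * S⁻¹ * αx).PosDef := by
  have := hS.inv.conjTranspose_mul_mul_same (mulVec_injective_of_linearIndependent_col hαx)
  rwa [Matrix.conjTranspose_eq_transpose_of_trivial] at this

theorem projMatrix_colSpan {p r : ℕ} (B : Matrix (Fin p) (Fin r) ℝ) (hB : IsUnit (Bᵀ * B)) :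
    projMatrix (colSpan B) = B * (Bᵀ * B)⁻¹ * Bᵀ := by
  have hd := (Matrix.isUnit_iff_isUnit_det _).1 hB
  ext i j
  have : (colSpan B).starProjection (EuclideanSpace.single j (1 : ℝ)) =
      WithLp.toLp 2 ((B * (Bᵀ * B)⁻¹ * Bᵀ) *ᵥ Pi.single j 1) := by
    -- The projection is characterized by lying in the column space and leaving a residual killed by
    -- `Bᵀ`.
    apply Submodule.eq_starProjection_of_mem_of_inner_eq_zero
    · have h : (B * (Bᵀ * B)⁻¹ * Bᵀ) *ᵥ Pi.single j 1
          = B *ᵥ (((Bᵀ * B)⁻¹ * Bᵀ) *ᵥ Pi.single j 1) := by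
        rw [Matrix.mulVec_mulVec, Matrix.mul_assoc]
      rw [h, Matrix.mulVec_eq_sum, WithLp.toLp_sum]
      refine Submodule.sum_mem _ fun k _ => ?_
      simp only [op_smul_eq_smul, WithLp.toLp_smul]
      exact Submodule.smul_mem _ _ (Submodule.subset_span ⟨k, rfl⟩)
    · intro w hw
      refine Submodule.span_induction ?_ (by simp) ?_ ?_ hw
      · rintro _ ⟨k, rfl⟩
        have h0 : Bᵀ *ᵥ (Pi.single j 1 - (B * (Bᵀ * B)⁻¹ * Bᵀ) *ᵥ Pi.single j 1) = 0 := by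
          rw [Matrix.mulVec_sub, Matrix.mulVec_mulVec, ← Matrix.mul_assoc, ← Matrix.mul_assoc,
            Matrix.mul_nonsing_inv _ hd, Matrix.one_mul, sub_self]
        have := congrFun h0 k
        simp only [EuclideanSpace.inner_eq_star_dotProduct, star_trivial]
        simp only [WithLp.ofLp_sub]
        change _ ⬝ᵥ _ = 0
        exact this
      · intro x y _ _ hx hy
        rw [inner_add_right, hx, hy, add_zero]
      · intro a x _ hx
        rw [inner_smul_right, hx, mul_zero]
  simp only [projMatrix, Matrix.of_apply, this]
  simp

/-! ### The test statistic as a quadratic form -/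

/-- `S⁻¹ α_x (α_xᵀ S⁻¹ α_x)⁻¹ α_xᵀ S⁻¹`. -/
def coefForm {p r : ℕ} (αx : Matrix (Fin p) (Fin r) ℝ) (S : Matrix (Fin p) (Fin p) ℝ) :
    Matrix (Fin p) (Fin p) ℝ :=
  S⁻¹ * αx * (αxᵀ * S⁻¹ * αx)⁻¹ * (αxᵀ * S⁻¹)

theorem posSemidef_covHat {h p n : ℕ} (d : Fin n → Obs h p) : (covHat d).PosSemidef := by
  refine Matrix.PosSemidef.smul (Matrix.posSemidef_sum _ fun i _ => ?_) (by positivity)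
  simpa using Matrix.posSemidef_vecMulVec_self_star ((d i).2 - meanHat d).ofLp

theorem trace_mul_vecMulVec_mul {p : ℕ} (A : Matrix (Fin p) (Fin p) ℝ) (v : Fin p → ℝ) :
    (A * Matrix.vecMulVec v v * A).trace = v ⬝ᵥ (A * A) *ᵥ v := by
  rw [Matrix.mul_vecMulVec, Matrix.vecMulVec_mul, Matrix.trace_vecMulVec, dotProduct_comm,
    ← Matrix.dotProduct_mulVec, Matrix.mulVec_mulVec]

/-- `(1/n) ∑_{Y_i = y} (X_i - X̄)`, the sample covariance of `X` and `J_y`. -/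
def sliceSum {h p n : ℕ} (d : Fin n → Obs h p) (y : Fin h) : Fin p → ℝ :=
  (n : ℝ)⁻¹ • ∑ i with (d i).1 = y, ((d i).2 - meanHat d).ofLp

theorem ZBar_ofLp {h p n : ℕ} (d : Fin n → Obs h p) (y : Fin h) :
    (ZBar d y).ofLp = (fHat d y)⁻¹ • (invSqrt (covHat d) *ᵥ sliceSum d y) := by
  have h1 : (count d y : ℝ)⁻¹ = (fHat d y)⁻¹ * (n : ℝ)⁻¹ := by
    rcases Nat.eq_zero_or_pos n with rfl | hn
    · simp [count]
    · have : (n : ℝ) ≠ 0 := by positivity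
      rw [fHat, inv_div]
      field_simp
  rw [ZBar, sliceSum, Matrix.mulVec_smul, smul_smul, ← h1]
  simp only [ZHat, WithLp.ofLp_smul, WithLp.ofLp_sum, Matrix.mulVec_sum,
    Matrix.ofLp_toEuclideanCLM]

/-- With `R = Σ̂^{-1/2}`, the Gram matrix of `R α_x` is `α_xᵀ Σ̂⁻¹ α_x`, so `R P_Ĥ R = K(Σ̂)`: only
`Σ̂⁻¹` survives. For singular `Σ̂` both sides are `0`. -/
theorem trace_projHat_mul {h p n r : ℕ} (αx : Matrix (Fin p) (Fin r) ℝ)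
    (hαx : LinearIndependent ℝ αx.col) (d : Fin n → Obs h p) (u : Fin p → ℝ) :
    (invSqrt (covHat d) *ᵥ u) ⬝ᵥ (projHat αx d * projHat αx d) *ᵥ (invSqrt (covHat d) *ᵥ u) =
      u ⬝ᵥ coefForm αx (covHat d) *ᵥ u := by
  by_cases hu : IsUnit (covHat d)
  · have hpd := posDef_of_isUnit (posSemidef_covHat d) hu
    have hG := (posDef_transpose_mul_inv_mul hpd hαx).isUnit
    set R := invSqrt (covHat d) with hR
    have hRR : R * R = (covHat d)⁻¹ := invSqrt_mul_self hpd.posSemidef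
    have hRt : Rᵀ = R := transpose_invSqrt _
    have hB : (R * αx)ᵀ * (R * αx) = αxᵀ * (covHat d)⁻¹ * αx := by
      rw [Matrix.transpose_mul, hRt, ← hRR]; simp only [Matrix.mul_assoc]
    have hP : projHat αx d
        = R * αx * (αxᵀ * (covHat d)⁻¹ * αx)⁻¹ * (R * αx)ᵀ := by
      rw [projHat, projMatrix_colSpan _ (by rw [← hR, hB]; exact hG), ← hR, hB]
    have hPP : projHat αx d * projHat αx d = projHat αx d := by
      have hd := (Matrix.isUnit_iff_isUnit_det _).1 hG
      calc projHat αx d * projHat αx d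
          = R * αx * ((αxᵀ * (covHat d)⁻¹ * αx)⁻¹ * ((R * αx)ᵀ * (R * αx))) *
            (αxᵀ * (covHat d)⁻¹ * αx)⁻¹ * (R * αx)ᵀ := by
              rw [hP]; simp only [Matrix.mul_assoc]
        _ = projHat αx d := by rw [hB, Matrix.nonsing_inv_mul _ hd, Matrix.mul_one, ← hP]
    have hK : coefForm αx (covHat d) = R * projHat αx d * R := by
      rw [hP, coefForm, ← hRR, Matrix.transpose_mul, hRt]; simp only [Matrix.mul_assoc]
    rw [hPP, hK, Matrix.dotProduct_mulVec, Matrix.dotProduct_mulVec, ← Matrix.vecMul_transpose, hRt,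
      Matrix.vecMul_vecMul, Matrix.vecMul_vecMul, ← Matrix.dotProduct_mulVec, Matrix.mul_assoc]
  · rw [invSqrt_eq_zero hu, coefForm]
    rw [Matrix.isUnit_iff_isUnit_det] at hu
    simp [Matrix.nonsing_inv_apply_not_isUnit _ hu]

theorem testStat_eq_sum {h p n r : ℕ} (αx : Matrix (Fin p) (Fin r) ℝ)
    (hαx : LinearIndependent ℝ αx.col) (d : Fin n → Obs h p) :
    testStat αx d =
      n * ∑ y, (fHat d y)⁻¹ * (sliceSum d y ⬝ᵥ coefForm αx (covHat d) *ᵥ sliceSum d y) := by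
  rw [testStat, MHat, Matrix.mul_sum, Matrix.sum_mul, Matrix.trace_sum]
  congr 1
  refine Finset.sum_congr rfl fun y _ => ?_
  rw [Matrix.mul_smul, Matrix.smul_mul, Matrix.trace_smul, trace_mul_vecMulVec_mul, ZBar_ofLp]
  simp only [Matrix.mulVec_smul, smul_dotProduct, dotProduct_smul, smul_eq_mul]
  rw [← Matrix.mulVec_mulVec, Matrix.mulVec_mulVec (M := projHat αx d), trace_projHat_mul αx hαx]
  -- The weight `f̂_y` meets two factors `f̂_y⁻¹`. In an empty slice all of these are `0`.
  by_cases h0 : fHat d y = 0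
  · simp [h0]
  · field_simp

/-- The quadratic form does not change when a multiple `S *ᵥ b` with `α_xᵀ b = 0` is
subtracted. -/
theorem coefForm_sub_mulVec {p r : ℕ} (αx : Matrix (Fin p) (Fin r) ℝ)
    {S : Matrix (Fin p) (Fin p) ℝ} (hS : S.PosSemidef) {b : Fin p → ℝ} (hb : αxᵀ *ᵥ b = 0)
    (u : Fin p → ℝ) :
    (u - S *ᵥ b) ⬝ᵥ coefForm αx S *ᵥ (u - S *ᵥ b) = u ⬝ᵥ coefForm αx S *ᵥ u := by
  by_cases hu : IsUnit S
  · have hd := (Matrix.isUnit_iff_isUnit_det _).1 hu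
    have hSt : Sᵀ = S := by
      have := hS.isHermitian
      rwa [Matrix.IsHermitian, Matrix.conjTranspose_eq_transpose_of_trivial] at this
    -- The last factor `S⁻¹` of the form cancels `S`, leaving `α_xᵀ b = 0`; symmetry of `S` gives
    -- the same on the left.
    have h1 : coefForm αx S *ᵥ (S *ᵥ b) = 0 := by
      rw [Matrix.mulVec_mulVec, coefForm, Matrix.mul_assoc _ (αxᵀ * S⁻¹) S,
        Matrix.mul_assoc αxᵀ S⁻¹ S, Matrix.nonsing_inv_mul _ hd, Matrix.mul_one, ← Matrix.mulVec_mulVec,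
        hb, Matrix.mulVec_zero]
    have h2 : (S *ᵥ b) ᵥ* coefForm αx S = 0 := by
      have h3 : S * coefForm αx S = αx * ((αxᵀ * S⁻¹ * αx)⁻¹ * (αxᵀ * S⁻¹)) := by
        rw [coefForm, Matrix.mul_assoc, Matrix.mul_assoc, ← Matrix.mul_assoc S,
          Matrix.mul_nonsing_inv _ hd, Matrix.one_mul]
      rw [← Matrix.vecMul_transpose, hSt, Matrix.vecMul_vecMul, h3, ← Matrix.vecMul_vecMul,
        ← Matrix.mulVec_transpose αx, hb, Matrix.zero_vecMul]
    rw [Matrix.mulVec_sub, h1, sub_zero, sub_dotProduct, Matrix.dotProduct_mulVec (S *ᵥ b), h2,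
      zero_dotProduct, sub_zero]
  · rw [Matrix.isUnit_iff_isUnit_det] at hu
    simp [coefForm, Matrix.nonsing_inv_apply_not_isUnit _ hu]

/-! ### Sample averages -/

/-- The sample average of `F`. -/
def avg {h p n : ℕ} (d : Fin n → Obs h p) (F : Obs h p → ℝ) : ℝ :=
  (n : ℝ)⁻¹ * ∑ i, F (d i)

theorem avg_add {h p n : ℕ} (d : Fin n → Obs h p) (F G : Obs h p → ℝ) :
    avg d (fun w => F w + G w) = avg d F + avg d G := by
  simp [avg, Finset.sum_add_distrib, mul_add]

theorem avg_sub {h p n : ℕ} (d : Fin n → Obs h p) (F G : Obs h p → ℝ) :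
    avg d (fun w => F w - G w) = avg d F - avg d G := by
  simp [avg, mul_sub]

theorem avg_mul_left {h p n : ℕ} (d : Fin n → Obs h p) (c : ℝ) (F : Obs h p → ℝ) :
    avg d (fun w => c * F w) = c * avg d F := by
  simp [avg, ← Finset.mul_sum]; ring

theorem avg_sum {h p n : ℕ} {ι : Type*} (s : Finset ι) (d : Fin n → Obs h p)
    (F : ι → Obs h p → ℝ) : avg d (fun w => ∑ k ∈ s, F k w) = ∑ k ∈ s, avg d (F k) := by
  simp [avg, Finset.mul_sum]; rw [Finset.sum_comm]

theorem avg_const {h p n : ℕ} (hn : n ≠ 0) (d : Fin n → Obs h p) (c : ℝ) :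
    avg d (fun _ => c) = c := by
  simp [avg, hn]

theorem meanHat_apply {h p n : ℕ} (d : Fin n → Obs h p) (a : Fin p) :
    meanHat d a = avg d fun w => w.2 a := by
  simp [meanHat, avg]

theorem fHat_eq_avg {h p n : ℕ} (d : Fin n → Obs h p) (y : Fin h) :
    fHat d y = avg d (J y) := by
  simp [fHat, count, avg, J, div_eq_inv_mul]

theorem covHat_apply {h p n : ℕ} (d : Fin n → Obs h p) (a b : Fin p) :
    covHat d a b = avg d fun w => (w.2 a - meanHat d a) * (w.2 b - meanHat d b) := by
  simp [covHat, avg, Matrix.sum_apply, Matrix.vecMulVec_apply]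

theorem sliceSum_apply {h p n : ℕ} (d : Fin n → Obs h p) (y : Fin h) (a : Fin p) :
    sliceSum d y a = avg d fun w => (w.2 a - meanHat d a) * J y w := by
  simp only [sliceSum, avg, J, Finset.sum_filter, Pi.smul_apply, Finset.sum_apply, smul_eq_mul]
  congr 1
  refine Finset.sum_congr rfl fun i _ => ?_
  split_ifs <;> simp

/-- Expresses `Σ̂` by averages of functions that do not depend on the sample, as the law of large
numbers and the measurability proof require. -/
theorem covHat_eq_avg {h p n : ℕ} (hn : n ≠ 0) (d : Fin n → Obs h p) (a b : Fin p) :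
    covHat d a b = avg d (fun w => w.2 a * w.2 b) -
      avg d (fun w => w.2 a) * avg d (fun w => w.2 b) := by
  rw [covHat_apply, meanHat_apply, meanHat_apply]
  set A := avg d (fun w => w.2 a)
  set B := avg d (fun w => w.2 b)
  have : (fun w : Obs h p => (w.2 a - A) * (w.2 b - B)) =
      fun w => ((w.2 a * w.2 b - B * w.2 a) - A * w.2 b) + A * B := by
    ext w; ring
  rw [this, avg_add, avg_sub, avg_sub, avg_mul_left, avg_mul_left, avg_const hn]
  ring

/-- Sample covariances with `J_y`, corrected by the population regression on `X`, are averages of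
`(X - E X) ε_y` up to a product of two averages. -/
theorem sliceSum_sub_mulVec_beta {h p n : ℕ} (hn : n ≠ 0) (P : Measure (Obs h p))
    (d : Fin n → Obs h p) (y : Fin h) (a : Fin p) :
    (sliceSum d y - covHat d *ᵥ beta P y) a =
      avg d (fun w => (w.2 a - meanX P a) * eps P w y) -
        (meanHat d a - meanX P a) * avg d (fun w => eps P w y) := by
  have hc : avg d (fun w => w.2 a - meanHat d a) = 0 := by
    rw [avg_sub, avg_const hn, meanHat_apply, sub_self]
  have e1 : (sliceSum d y - covHat d *ᵥ beta P y) a =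
      avg d (fun w => (w.2 a - meanHat d a) * eps P w y) := by
    -- The last coefficient collects `f_y` and the shift `β_yᵀ (X̄ - E X)`. It is constant in `w`,
    -- so its product with `X - X̄` averages to zero by `hc`.
    have : (fun w : Obs h p => (w.2 a - meanHat d a) * eps P w y) = fun w =>
        ((w.2 a - meanHat d a) * J y w -
          ∑ b, beta P y b * ((w.2 a - meanHat d a) * (w.2 b - meanHat d b))) -
        (f P y + ∑ b, beta P y b * (meanHat d b - meanX P b)) * (w.2 a - meanHat d a) := by
      ext w
      have : beta P y ⬝ᵥ (w.2 - meanX P).ofLp =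
          ∑ b, beta P y b * (w.2 b - meanHat d b)
            + ∑ b, beta P y b * (meanHat d b - meanX P b) := by
        rw [← Finset.sum_add_distrib]
        exact Finset.sum_congr rfl fun b _ => by simp; ring
      rw [eps, this]
      have : ∑ b, beta P y b * ((w.2 a - meanHat d a) * (w.2 b - meanHat d b)) =
          (w.2 a - meanHat d a) * ∑ b, beta P y b * (w.2 b - meanHat d b) := by
        rw [Finset.mul_sum]; exact Finset.sum_congr rfl fun b _ => by ring
      rw [this]; ring
    rw [this, avg_sub, avg_sub, avg_mul_left, hc, avg_sum, mul_zero, sub_zero, Pi.sub_apply,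
      sliceSum_apply]
    refine congrArg₂ _ rfl ?_
    simp only [Matrix.mulVec, dotProduct]
    refine Finset.sum_congr rfl fun b _ => ?_
    rw [avg_mul_left, covHat_apply, mul_comm]
  rw [e1, ← avg_mul_left, ← avg_sub]
  congr 1
  ext w
  ring

/-- Exact for every sample. The factor `n` is shared as one `√n` per side, so that only quantities
with a limit law or a constant limit appear. -/
theorem testStat_eq_sum_resid {h p n r : ℕ} (P : Measure (Obs h p))
    (αx : Matrix (Fin p) (Fin r) ℝ) (hαx : LinearIndependent ℝ αx.col)
    (hβ : ∀ y, αxᵀ *ᵥ beta P y = 0) (d : Fin n → Obs h p) :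
    testStat αx d = ∑ y, (fHat d y)⁻¹ * ∑ a, ∑ b, coefForm αx (covHat d) a b *
      (√n * avg d (fun w => (w.2 a - meanX P a) * eps P w y) -
        (meanHat d a - meanX P a) * (√n * avg d (fun w => eps P w y))) *
      (√n * avg d (fun w => (w.2 b - meanX P b) * eps P w y) -
        (meanHat d b - meanX P b) * (√n * avg d (fun w => eps P w y))) := by
  rcases eq_or_ne n 0 with rfl | hn
  · simp [testStat, fHat]
  rw [testStat_eq_sum αx hαx, Finset.mul_sum]
  refine Finset.sum_congr rfl fun y _ => ?_
  rw [← coefForm_sub_mulVec αx (posSemidef_covHat d) (hβ y), mul_left_comm]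
  congr 1
  simp only [dotProduct, Matrix.mulVec, Finset.mul_sum]
  refine Finset.sum_congr rfl fun a _ => Finset.sum_congr rfl fun b _ => ?_
  rw [sliceSum_sub_mulVec_beta hn, sliceSum_sub_mulVec_beta hn]
  have hs : (n : ℝ) = √n * √n := (Real.mul_self_sqrt (Nat.cast_nonneg n)).symm
  generalize avg d (fun w => (w.2 a - meanX P a) * eps P w y) = A
  generalize avg d (fun w => (w.2 b - meanX P b) * eps P w y) = B
  generalize avg d (fun w => eps P w y) = C
  calc _ = (√n * √n) * ((A - (meanHat d a - meanX P a) * C) *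
        (coefForm αx (covHat d) a b * (B - (meanHat d b - meanX P b) * C))) := by rw [← hs]
    _ = _ := by ring

/-! ### The multivariate central limit theorem -/

/-- The Cramér–Wold device: the vector characteristic function is read off from one-dimensional
projections. -/
theorem charFun_map_eq_charFun_map_inner {Ω ι : Type*} [Fintype ι] [MeasurableSpace Ω]
    {ν : Measure Ω} {X : Ω → EuclideanSpace ℝ ι} (hX : AEMeasurable X ν)
    (t : EuclideanSpace ℝ ι) :
    charFun (ν.map X) t = charFun (ν.map fun ω => inner ℝ (X ω) t) 1 := by
  rw [charFun_apply, charFun_apply, integral_map hX (by fun_prop),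
    integral_map (by fun_prop) (by fun_prop)]
  simp

/-- A multivariate central limit theorem: normalized sums of centered i.i.d. random vectors
converge in distribution to the measure whose characteristic function is Gaussian with the same
second moments. -/
theorem tendstoInDistribution_inv_sqrt_smul_sum {Ω ι : Type*} [Fintype ι] [MeasurableSpace Ω]
    {ν : Measure Ω} [IsProbabilityMeasure ν] {V : ℕ → Ω → EuclideanSpace ℝ ι}
    (hindep : iIndepFun V ν) (hident : ∀ i, IdentDistrib (V i) (V 0) ν ν)
    (hL2 : MemLp (V 0) 2 ν) (h0 : ∀ t, ∫ ω, inner ℝ (V 0 ω) t ∂ν = 0)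
    (Q : Measure (EuclideanSpace ℝ ι)) [IsProbabilityMeasure Q]
    (hQ : ∀ t, charFun Q t = Complex.exp (-(((∫ ω, inner ℝ (V 0 ω) t ^ 2 ∂ν) / 2 : ℝ) : ℂ))) :
    TendstoInDistribution (fun (n : ℕ) ω => (√n)⁻¹ • ∑ k ∈ Finset.range n, V k ω) atTop
      (fun x => x) (fun _ => ν) Q := by
  have hm : ∀ i, AEMeasurable (V i) ν := fun i => (hident i).aemeasurable_fst
  have hs : ∀ n : ℕ, AEMeasurable (fun ω => (√n)⁻¹ • ∑ k ∈ Finset.range n, V k ω) ν := fun n =>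
    (Finset.aemeasurable_fun_sum (Finset.range n) fun k _ => hm k).const_smul (√n)⁻¹
  refine ⟨hs, aemeasurable_id', ?_⟩
  refine ProbabilityMeasure.tendsto_iff_tendsto_charFun.2 fun t => ?_
  simp only [ProbabilityMeasure.coe_mk, Measure.map_id']
  have hmeas : Measurable fun x : EuclideanSpace ℝ ι => inner ℝ x t := by fun_prop
  set W : ℕ → Ω → ℝ := fun k ω => inner ℝ (V k ω) t with hW
  have hWL2 : MemLp (W 0) 2 ν := hL2.inner_const t
  have h1 := tendstoInDistribution_inv_sqrt_mul_sum_sub (P := ν) (X := W)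
    (Y := fun x : ℝ => x) (P' := gaussianReal 0 Var[W 0; ν].toNNReal) ⟨by fun_prop, Measure.map_id'⟩
    hWL2 (hindep.comp (fun _ x => inner ℝ x t) fun _ => hmeas)
    (fun i => (hident i).comp hmeas)
  -- The direction `t` is already absorbed in `W`, so frequency `1` suffices.
  have h2 := ProbabilityMeasure.tendsto_iff_tendsto_charFun.1 h1.tendsto 1
  simp only [ProbabilityMeasure.coe_mk, Measure.map_id', charFun_gaussianReal] at h2
  have hv : Var[W 0; ν] = ∫ ω, inner ℝ (V 0 ω) t ^ 2 ∂ν := by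
    rw [variance_of_integral_eq_zero hWL2.aemeasurable (h0 t)]
  rw [hQ t]
  convert h2 using 2
  · rw [charFun_map_eq_charFun_map_inner (hs _)]
    congr 2
    ext ω
    have : ∫ ω, W 0 ω ∂ν = 0 := h0 t
    simp [W, this, inner_smul_left, sum_inner]
  · rw [← hv, Real.coe_toNNReal _ (variance_nonneg _ _)]
    push_cast
    congr 1
    simp

/-- Supplies the limit law for the central limit theorem. The second moment matrix `Γ` has quadratic
form `E⟨V, t⟩²`, hence is positive semidefinite; it need not be invertible. -/
theorem exists_charFun_eq_of_memLp_two {Ω ι : Type*} [Fintype ι] [DecidableEq ι]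
    [MeasurableSpace Ω] {ν : Measure Ω} [IsProbabilityMeasure ν]
    {V : Ω → EuclideanSpace ℝ ι} (hV : MemLp V 2 ν) :
    ∃ Q : Measure (EuclideanSpace ℝ ι), IsProbabilityMeasure Q ∧
      ∀ t, charFun Q t = Complex.exp (-(((∫ ω, inner ℝ (V ω) t ^ 2 ∂ν) / 2 : ℝ) : ℂ)) := by
  set Γ : Matrix ι ι ℝ := Matrix.of fun a b => ∫ ω, V ω a * V ω b ∂ν with hΓ
  have hVa : ∀ a, MemLp (fun ω => V ω a) 2 ν := fun a => by
    simpa [EuclideanSpace.inner_single_right] using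
      hV.inner_const (𝕜 := ℝ) (EuclideanSpace.single a (1 : ℝ))
  have hquad : ∀ t : EuclideanSpace ℝ ι,
      t.ofLp ⬝ᵥ Γ *ᵥ t.ofLp = ∫ ω, inner ℝ (V ω) t ^ 2 ∂ν := fun t => by
    have hint : ∀ a b, Integrable (fun ω => V ω a * V ω b) ν := fun a b =>
      (hVa a).integrable_mul (hVa b)
    have : ∀ ω, inner ℝ (V ω) t ^ 2 = ∑ a, ∑ b, t a * t b * (V ω a * V ω b) := fun ω => by
      simp only [PiLp.inner_apply, sq, Finset.sum_mul_sum]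
      exact Finset.sum_congr rfl fun a _ => Finset.sum_congr rfl fun b _ => by simp; ring
    simp_rw [this]
    rw [integral_finsetSum _ fun a _ => integrable_finsetSum _ fun b _ => (hint a b).const_mul _]
    simp only [dotProduct, Matrix.mulVec, Finset.mul_sum]
    refine Finset.sum_congr rfl fun a _ => ?_
    rw [integral_finsetSum _ fun b _ => (hint a b).const_mul _]
    refine Finset.sum_congr rfl fun b _ => ?_
    rw [integral_const_mul, hΓ, Matrix.of_apply]
    ring
  have hpsd : Γ.PosSemidef := by
    refine Matrix.PosSemidef.of_dotProduct_mulVec_nonneg ?_ fun x => ?_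
    · ext a b
      simp [hΓ, mul_comm]
    · rw [star_trivial, show x ⬝ᵥ Γ *ᵥ x = _ from hquad (WithLp.toLp 2 x)]
      exact integral_nonneg fun ω => sq_nonneg _
  refine ⟨multivariateGaussian 0 Γ, inferInstance, fun t => ?_⟩
  rw [charFun_multivariateGaussian hpsd]
  rw [inner_zero_right]
  have h := hquad t
  congr 1
  rw [← h]
  simp

/-! ### Weighted sums of chi-squared variables -/

/-- All the independent chi-squared variables are realized on one standard Gaussian array, row `j`
giving `χ²_j`. -/
theorem map_pi_chiSquared {m r : ℕ} (d : Fin m → ℝ) :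
    (Measure.pi fun _ : Fin m => chiSquared r).map (fun c => ∑ j, d j * c j) =
      (stdGaussian (EuclideanSpace ℝ (Fin m × Fin r))).map
        (fun x => ∑ j, d j * ∑ k, x (j, k) ^ 2) := by
  have h1 : (Measure.pi fun _ : Fin m => chiSquared r) =
      (Measure.pi fun _ : Fin m => Measure.pi fun _ : Fin r => gaussianReal 0 1).map
        fun x j => ∑ k, x j k ^ 2 := by
    exact (Measure.pi_map_pi (μ := fun _ : Fin m => Measure.pi fun _ : Fin r => gaussianReal 0 1)
      (f := fun _ x => ∑ k, x k ^ 2) (hμ := fun _ => inferInstanceAs (SigmaFinite (chiSquared r)))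
      fun _ => Measurable.aemeasurable (by fun_prop)).symm
  have h2 : (Measure.pi fun _ : Fin m => Measure.pi fun _ : Fin r => gaussianReal 0 1) =
      (Measure.pi fun _ : Fin m × Fin r => gaussianReal 0 1).map
        (MeasurableEquiv.curry (Fin m) (Fin r) ℝ) := by
    have := Measure.infinitePi_map_curry (fun (_ : Fin m) (_ : Fin r) => gaussianReal 0 1)
    simp only [Measure.infinitePi_eq_pi] at this
    exact this.symm
  rw [h1, h2, ← map_pi_eq_stdGaussian, Measure.map_map (by fun_prop) (by fun_prop),
    Measure.map_map (by fun_prop) (by fun_prop), Measure.map_map (by fun_prop) (by fun_prop)]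
  rfl

/-- If `Q` is the centered Gaussian law with covariance `A ⊗ I`, where `A = ∑ d_j u_j u_jᵀ` with
orthonormal `u_j`, then the squared norm has under `Q` the law of `∑ d_j χ²_j`. -/
theorem map_norm_sq_eq_map_chiSquared {h m r : ℕ} {A : Matrix (Fin h) (Fin h) ℝ}
    {d : Fin m → ℝ} (hd : ∀ j, 0 ≤ d j) {u : Fin m → EuclideanSpace ℝ (Fin h)}
    (hu : Orthonormal ℝ u)
    (hA : ∀ x : EuclideanSpace ℝ (Fin h),
      x.ofLp ⬝ᵥ A *ᵥ x.ofLp = ∑ j, d j * inner ℝ (u j) x ^ 2)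
    (Q : Measure (EuclideanSpace ℝ (Fin h × Fin r))) [IsProbabilityMeasure Q]
    (hQ : ∀ t : EuclideanSpace ℝ (Fin h × Fin r), charFun Q t =
      Complex.exp (-(((∑ k, (fun y => t (y, k)) ⬝ᵥ A *ᵥ fun y => t (y, k)) / 2 : ℝ) : ℂ))) :
    Q.map (fun x => ‖x‖ ^ 2) =
      (Measure.pi fun _ : Fin m => chiSquared r).map (fun c => ∑ j, d j * c j) := by
  -- `B` is a square root of the covariance: `B Bᵀ = A ⊗ I`, so `Q` is the image of the standard
  -- Gaussian under `B`.
  let B : EuclideanSpace ℝ (Fin m × Fin r) → EuclideanSpace ℝ (Fin h × Fin r) := fun c =>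
    WithLp.toLp 2 fun a => ∑ j, √(d j) * u j a.1 * c (j, a.2)
  have hB : Measurable B := by fun_prop
  have key : Q = (stdGaussian (EuclideanSpace ℝ (Fin m × Fin r))).map B := by
    have : IsProbabilityMeasure ((stdGaussian (EuclideanSpace ℝ (Fin m × Fin r))).map B) :=
      Measure.isProbabilityMeasure_map hB.aemeasurable
    refine Measure.ext_of_charFun ?_
    ext t
    -- `s = Bᵀ t`.
    let s : EuclideanSpace ℝ (Fin m × Fin r) := WithLp.toLp 2 fun a =>
      √(d a.1) * inner ℝ (u a.1) (WithLp.toLp 2 fun y => t (y, a.2))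
    have hBs : ∀ c, inner ℝ (B c) t = inner ℝ c s := fun c => by
      simp only [PiLp.inner_apply, B, s, Fintype.sum_prod_type, RCLike.inner_apply, conj_trivial,
        Finset.mul_sum, Finset.sum_mul]
      rw [Finset.sum_comm, Finset.sum_comm (s := (Finset.univ : Finset (Fin m)))]
      refine Finset.sum_congr rfl fun k _ => ?_
      rw [Finset.sum_comm]
      exact Finset.sum_congr rfl fun j _ => Finset.sum_congr rfl fun y _ => by ring
    have h1 : charFun ((stdGaussian (EuclideanSpace ℝ (Fin m × Fin r))).map B) t =
        charFun (stdGaussian (EuclideanSpace ℝ (Fin m × Fin r))) s := by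
      rw [charFun_apply, charFun_apply, integral_map hB.aemeasurable (by fun_prop)]
      simp_rw [hBs]
    rw [h1, charFun_stdGaussian, hQ]
    congr 1
    have h2 : ‖s‖ ^ 2 = ∑ k, (fun y => t (y, k)) ⬝ᵥ A *ᵥ fun y => t (y, k) := by
      rw [EuclideanSpace.real_norm_sq_eq, Fintype.sum_prod_type, Finset.sum_comm]
      refine Finset.sum_congr rfl fun k _ => ?_
      rw [hA (WithLp.toLp 2 fun y => t (y, k))]
      refine Finset.sum_congr rfl fun j _ => ?_
      simp only [s, mul_pow, Real.sq_sqrt (hd j)]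
    rw [← h2]
    push_cast
    ring
  rw [key, map_pi_chiSquared, Measure.map_map (by fun_prop) hB]
  congr 1
  ext c
  -- Pythagoras for the orthonormal `u_j`, separately for each `k`.
  have h3 : ∀ k, ∑ y, (∑ j, √(d j) * u j y * c (j, k)) ^ 2 = ∑ j, d j * c (j, k) ^ 2 := fun k => by
    have h4 : ‖∑ j, (√(d j) * c (j, k)) • u j‖ ^ 2 = ∑ j, (√(d j) * c (j, k)) ^ 2 := by
      rw [← real_inner_self_eq_norm_sq, hu.inner_sum]
      simp [sq]
    rw [EuclideanSpace.real_norm_sq_eq] at h4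
    simp only [mul_pow, Real.sq_sqrt (hd _)] at h4
    rw [← h4]
    refine Finset.sum_congr rfl fun y _ => ?_
    congr 1
    simp only [WithLp.ofLp_sum, WithLp.ofLp_smul, Finset.sum_apply, Pi.smul_apply, smul_eq_mul]
    exact Finset.sum_congr rfl fun j _ => by ring
  simp only [Function.comp, EuclideanSpace.real_norm_sq_eq, B, Fintype.sum_prod_type]
  rw [Finset.sum_comm]
  simp_rw [h3, Finset.mul_sum]
  rw [Finset.sum_comm]

/-! ### Spectrum of `Q_g - μᵀ μ`. -/

/-- The eigenvector basis is labelled through a chosen bijection of index types; it is reindexed so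
that the `j`-th vector belongs to the `j`-th largest eigenvalue. -/
theorem exists_orthonormalBasis_delta {h p : ℕ} (P : Measure (Obs h p)) :
    ∃ u : OrthonormalBasis (Fin h) ℝ (EuclideanSpace ℝ (Fin h)),
      ∀ j, Delta P *ᵥ (u j).ofLp = delta P j • (u j).ofLp := by
  let e : Fin (Fintype.card (Fin h)) ≃ Fin h := Fintype.equivOfCardEq (Fintype.card_fin _)
  let σ : Fin h ≃ Fin h := (finCongr (Fintype.card_fin h).symm).trans e
  refine ⟨(isHermitian_Delta P).eigenvectorBasis.reindex σ.symm, fun j => ?_⟩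
  rw [OrthonormalBasis.reindex_apply, Equiv.symm_symm,
    Matrix.IsHermitian.mulVec_eigenvectorBasis]
  congr 1
  simp only [delta, Matrix.IsHermitian.eigenvalues]
  congr 1
  simp [σ, e]

theorem antitone_delta {h p : ℕ} (P : Measure (Obs h p)) : Antitone (delta P) := fun _ _ hij =>
  (isHermitian_Delta P).eigenvalues₀_antitone (by simpa using hij)

theorem dotProduct_mulVec_eq_sum_inner {h : ℕ} {A : Matrix (Fin h) (Fin h) ℝ}
    {d : Fin h → ℝ} (u : OrthonormalBasis (Fin h) ℝ (EuclideanSpace ℝ (Fin h)))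
    (hA : ∀ j, A *ᵥ (u j).ofLp = d j • (u j).ofLp) (x : EuclideanSpace ℝ (Fin h)) :
    x.ofLp ⬝ᵥ A *ᵥ x.ofLp = ∑ j, d j * inner ℝ (u j) x ^ 2 := by
  have h1 : A *ᵥ x.ofLp = ∑ j, (inner ℝ (u j) x * d j) • (u j).ofLp := by
    conv_lhs => rw [← u.sum_repr' x]
    simp only [WithLp.ofLp_sum, WithLp.ofLp_smul, Matrix.mulVec_sum, Matrix.mulVec_smul, hA,
      smul_smul]
  rw [h1, dotProduct_sum]
  refine Finset.sum_congr rfl fun j _ => ?_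
  rw [dotProduct_smul, smul_eq_mul]
  have : x.ofLp ⬝ᵥ (u j).ofLp = inner ℝ (u j) x := by
    simp [EuclideanSpace.inner_eq_star_dotProduct]
  rw [this]
  ring

theorem delta_nonneg {h p : ℕ} {P : Measure (Obs h p)} (hP : (Delta P).PosSemidef) (j : Fin h) :
    0 ≤ delta P j := by
  obtain ⟨u, hu⟩ := exists_orthonormalBasis_delta P
  have h1 := hP.dotProduct_mulVec_nonneg (u j).ofLp
  rw [star_trivial, dotProduct_mulVec_eq_sum_inner u hu] at h1
  simpa [u.inner_eq_ite] using h1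

/-- If the smallest eigenvalue were positive, the quadratic form would be definite, and a nonzero
kernel vector could not exist. -/
theorem delta_last_eq_zero {h p : ℕ} {P : Measure (Obs h p)} (hP : (Delta P).PosSemidef)
    {v : Fin h → ℝ} (hv : v ≠ 0) (hv0 : Delta P *ᵥ v = 0) (j : Fin h) (hj : (j : ℕ) + 1 = h) :
    delta P j = 0 := by
  obtain ⟨u, hu⟩ := exists_orthonormalBasis_delta P
  refine le_antisymm ?_ (delta_nonneg hP j)
  by_contra! hpos
  have hall : ∀ i, 0 < delta P i := fun i =>
    hpos.trans_le (antitone_delta P (Fin.le_def.2 (by omega)))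
  have h1 := dotProduct_mulVec_eq_sum_inner u hu (WithLp.toLp 2 v)
  rw [hv0, dotProduct_zero, eq_comm, Finset.sum_eq_zero_iff_of_nonneg
    (fun i _ => mul_nonneg (hall i).le (sq_nonneg _))] at h1
  apply hv
  have h2 : WithLp.toLp 2 v = (0 : EuclideanSpace ℝ (Fin h)) := by
    rw [← u.sum_repr' (WithLp.toLp 2 v)]
    refine Finset.sum_eq_zero fun i hi => ?_
    have := (mul_eq_zero.1 (h1 i hi)).resolve_left (hall i).ne'
    rw [pow_eq_zero_iff two_ne_zero] at this
    rw [this, zero_smul]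
  simpa using congrArg WithLp.ofLp h2

/-- For `Q` centered Gaussian with covariance `(Q_g - μᵀ μ) ⊗ I`, the squared norm has under `Q`
the law of `∑_{j < h} δ_j χ²_j`. -/
theorem map_norm_sq_eq_map_delta {h p r : ℕ} {P : Measure (Obs h p)} (hP : (Delta P).PosSemidef)
    (hlast : ∀ j : Fin h, (j : ℕ) + 1 = h → delta P j = 0)
    (Q : Measure (EuclideanSpace ℝ (Fin h × Fin r))) [IsProbabilityMeasure Q]
    (hQ : ∀ t : EuclideanSpace ℝ (Fin h × Fin r), charFun Q t =
      Complex.exp (-(((∑ k, (fun y => t (y, k)) ⬝ᵥ Delta P *ᵥ fun y => t (y, k)) / 2 : ℝ) : ℂ))) :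
    Q.map (fun x => ‖x‖ ^ 2) =
      (Measure.pi fun _ : Fin (h - 1) => chiSquared r).map
        (fun c => ∑ j, delta P (Fin.castLE (Nat.sub_le h 1) j) * c j) := by
  obtain ⟨u, hu⟩ := exists_orthonormalBasis_delta P
  refine map_norm_sq_eq_map_chiSquared (u := fun j => u (Fin.castLE (Nat.sub_le h 1) j))
    (fun j => delta_nonneg hP _) (u.orthonormal.comp _ (Fin.castLE_injective _)) (fun x => ?_) Q hQ
  rw [dotProduct_mulVec_eq_sum_inner u hu]
  rcases h with _ | m
  · rfl
  · rw [Fin.sum_univ_castSucc, hlast (Fin.last m) (by simp), zero_mul, add_zero]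
    rfl

/-! ### Population moments -/

theorem memLp_coord {h p : ℕ} {P : Measure (Obs h p)}
    (hmom : MemLp (fun w : Obs h p => w.2) 4 P) (a : Fin p) :
    MemLp (fun w : Obs h p => w.2 a) 4 P := by
  simpa [EuclideanSpace.inner_single_right] using
    hmom.inner_const (𝕜 := ℝ) (EuclideanSpace.single a (1 : ℝ))

theorem memLp_coord_sub {h p : ℕ} {P : Measure (Obs h p)} [IsProbabilityMeasure P]
    (hmom : MemLp (fun w : Obs h p => w.2) 4 P) (a : Fin p) :
    MemLp (fun w : Obs h p => w.2 a - meanX P a) 4 P :=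
  (memLp_coord hmom a).sub (memLp_const _)

/-- Hölder with `1/4 + 1/4 = 1/2`. This is why fourth moments are assumed: products such as `(X - E
X) ε_y` need finite variance. -/
theorem memLp_mul_two {α : Type*} [MeasurableSpace α] {μ : Measure α} {F G : α → ℝ}
    (hF : MemLp F 4 μ) (hG : MemLp G 4 μ) : MemLp (fun w => F w * G w) 2 μ := by
  have : ENNReal.HolderTriple 4 4 2 := ⟨by
    have h4 : (4 : ENNReal) = 2 * 2 := by norm_num
    rw [h4, ENNReal.mul_inv (by simp) (by simp), ← mul_add, ENNReal.inv_two_add_inv_two, mul_one]⟩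
  exact hG.mul hF

theorem integrable_mul_of_memLp_four {α : Type*} [MeasurableSpace α] {μ : Measure α}
    [IsFiniteMeasure μ] {F G : α → ℝ} (hF : MemLp F 4 μ) (hG : MemLp G 4 μ) :
    Integrable (fun w => F w * G w) μ :=
  (memLp_mul_two hF hG).integrable (by norm_num)

theorem integral_sub_sub_sum {α ι : Type*} [MeasurableSpace α] {μ : Measure α} [Fintype ι]
    {F G : α → ℝ} {H : ι → α → ℝ} (hF : Integrable F μ) (hG : Integrable G μ)
    (hH : ∀ i, Integrable (H i) μ) :
    ∫ w, (F w - G w - ∑ i, H i w) ∂μ = ∫ w, F w ∂μ - ∫ w, G w ∂μ - ∑ i, ∫ w, H i w ∂μ := by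
  rw [integral_sub (f := fun w => F w - G w) (hF.sub hG) (integrable_finsetSum _ fun i _ => hH i),
    integral_sub hF hG, integral_finsetSum _ fun i _ => hH i]

theorem memLp_J {h p : ℕ} (P : Measure (Obs h p)) [IsProbabilityMeasure P] (y : Fin h)
    (q : ENNReal) : MemLp (J (p := p) y) q P := by
  refine MemLp.of_bound (Measurable.aestronglyMeasurable ?_) 1 (.of_forall fun w => ?_)
  · exact Measurable.ite (measurable_fst (measurableSet_singleton y)) measurable_const
      measurable_const
  · unfold J; split_ifs <;> simp

theorem measurable_J {h p : ℕ} (y : Fin h) : Measurable (J (p := p) y) :=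
  Measurable.ite (measurable_fst (measurableSet_singleton y)) measurable_const measurable_const

theorem J_eq_indicator {h p : ℕ} (y : Fin h) :
    J (p := p) y = {w : Obs h p | w.1 = y}.indicator fun _ => (1 : ℝ) := by
  ext w
  simp [J, Set.indicator_apply]

theorem measurableSet_slice {h p : ℕ} (y : Fin h) : MeasurableSet {w : Obs h p | w.1 = y} :=
  measurable_fst (measurableSet_singleton y)

theorem integral_J {h p : ℕ} (P : Measure (Obs h p)) (y : Fin h) : ∫ w, J y w ∂P = f P y := by
  rw [J_eq_indicator, integral_indicator_const _ (measurableSet_slice y)]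
  simp [f]

theorem integral_J_mul {h p : ℕ} (P : Measure (Obs h p)) (y : Fin h) (F : Obs h p → ℝ) :
    ∫ w, J y w * F w ∂P = ∫ w in {w | w.1 = y}, F w ∂P := by
  rw [← integral_indicator (measurableSet_slice y)]
  congr 1
  ext w
  simp [J, Set.indicator_apply]

theorem meanX_apply {h p : ℕ} {P : Measure (Obs h p)} [IsProbabilityMeasure P]
    (hmom : MemLp (fun w : Obs h p => w.2) 4 P) (a : Fin p) :
    meanX P a = ∫ w, w.2 a ∂P :=
  ((EuclideanSpace.proj (𝕜 := ℝ) a).integral_comp_comm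
    (hmom.integrable (by norm_num))).symm

theorem integral_coord_sub {h p : ℕ} {P : Measure (Obs h p)} [IsProbabilityMeasure P]
    (hmom : MemLp (fun w : Obs h p => w.2) 4 P) (a : Fin p) :
    ∫ w : Obs h p, (w.2 a - meanX P a) ∂P = 0 := by
  rw [integral_sub ((memLp_coord hmom a).integrable (by norm_num)) (integrable_const _),
    meanX_apply hmom]
  simp

theorem covX_apply {h p : ℕ} {P : Measure (Obs h p)} [IsProbabilityMeasure P]
    (hmom : MemLp (fun w : Obs h p => w.2) 4 P) (a b : Fin p) :
    covX P a b = ∫ w : Obs h p, (w.2 a - meanX P a) * (w.2 b - meanX P b) ∂P := by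
  simp [covX, covariance, meanX_apply hmom]

/-- `Cov(X, J_y)`. -/
def covXJ {h p : ℕ} (P : Measure (Obs h p)) (y : Fin h) : Fin p → ℝ :=
  fun i => cov[fun w : Obs h p => w.2 i, J y; P]

theorem covXJ_apply {h p : ℕ} {P : Measure (Obs h p)} [IsProbabilityMeasure P]
    (hmom : MemLp (fun w : Obs h p => w.2) 4 P) (y : Fin h) (a : Fin p) :
    covXJ P y a = ∫ w : Obs h p, (w.2 a - meanX P a) * J y w ∂P := by
  have h1 := memLp_coord_sub hmom a
  simp only [covXJ, covariance, ← meanX_apply hmom, mul_sub]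
  rw [integral_sub (integrable_mul_of_memLp_four h1 (memLp_J P y 4))
    ((h1.integrable (by norm_num)).mul_const _), integral_mul_const, integral_coord_sub hmom]
  simp

theorem Z_apply {h p : ℕ} (P : Measure (Obs h p)) (w : Obs h p) (i : Fin p) :
    Z P w i = ∑ a, invSqrt (covX P) i a * (w.2 a - meanX P a) := by
  rw [Z, Matrix.ofLp_toEuclideanCLM]
  rfl

theorem Z_ofLp {h p : ℕ} (P : Measure (Obs h p)) (w : Obs h p) :
    (Z P w).ofLp = invSqrt (covX P) *ᵥ (w.2 - meanX P).ofLp := by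
  rw [Z, Matrix.ofLp_toEuclideanCLM]

theorem memLp_Z {h p : ℕ} {P : Measure (Obs h p)} [IsProbabilityMeasure P]
    (hmom : MemLp (fun w : Obs h p => w.2) 4 P) (i : Fin p) :
    MemLp (fun w : Obs h p => Z P w i) 4 P := by
  simp_rw [Z_apply]
  exact memLp_finsetSum _ fun a _ => (memLp_coord_sub hmom a).const_mul _

theorem integral_Z_apply {h p : ℕ} {P : Measure (Obs h p)} [IsProbabilityMeasure P]
    (hmom : MemLp (fun w : Obs h p => w.2) 4 P) (i : Fin p) :
    ∫ w : Obs h p, Z P w i ∂P = 0 := by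
  simp_rw [Z_apply]
  rw [integral_finsetSum _ fun a _ =>
    ((memLp_coord_sub hmom a).integrable (by norm_num)).const_mul _]
  simp_rw [integral_const_mul, integral_coord_sub hmom]
  simp

theorem integrable_Z {h p : ℕ} {P : Measure (Obs h p)} [IsProbabilityMeasure P]
    (hmom : MemLp (fun w : Obs h p => w.2) 4 P) : Integrable (Z P) P := by
  have h1 : Integrable (fun w : Obs h p => w.2 - meanX P) P :=
    (hmom.integrable (by norm_num)).sub (integrable_const _)
  exact (Matrix.toEuclideanCLM (𝕜 := ℝ) (invSqrt (covX P))).integrable_comp h1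

theorem invSqrt_mul_mul_invSqrt {m : ℕ} {A : Matrix (Fin m) (Fin m) ℝ} (hA : A.PosDef) :
    invSqrt A * A * invSqrt A = 1 := by
  have hd := (Matrix.isUnit_iff_isUnit_det _).1 hA.isUnit
  rw [mul_eq_one_comm, ← Matrix.mul_assoc, invSqrt_mul_self hA.posSemidef,
    Matrix.nonsing_inv_mul _ hd]

/-- `E(J_y Z)`. -/
def sliceZ {h p : ℕ} (P : Measure (Obs h p)) (y : Fin h) : Fin p → ℝ :=
  fun i => ∫ w, J y w * Z P w i ∂P

theorem sliceZ_eq_smul {h p : ℕ} {P : Measure (Obs h p)} [IsProbabilityMeasure P]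
    (hmom : MemLp (fun w : Obs h p => w.2) 4 P) (y : Fin h) (hy : 0 < f P y) :
    sliceZ P y = f P y • (condMeanZ P y).ofLp := by
  ext i
  have hint : Integrable (Z P) (P[|{w : Obs h p | w.1 = y}]) := by
    rw [ProbabilityTheory.cond]
    refine (integrable_Z hmom).integrableOn.smul_measure ?_
    rw [ENNReal.inv_ne_top]
    intro h0
    simp [f, measureReal_def, h0] at hy
  have h1 : condMeanZ P y i = ∫ w, Z P w i ∂(P[|{w : Obs h p | w.1 = y}]) :=
    ((EuclideanSpace.proj (𝕜 := ℝ) i).integral_comp_comm hint).symm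
  rw [Pi.smul_apply, h1, ProbabilityTheory.cond, integral_smul_measure, sliceZ, integral_J_mul, ENNReal.toReal_inv,
    smul_eq_mul, smul_eq_mul, ← measureReal_def]
  change _ = f P y * ((f P y)⁻¹ * _)
  rw [mul_inv_cancel_left₀ hy.ne']

theorem invSqrt_mulVec_covXJ {h p : ℕ} {P : Measure (Obs h p)} [IsProbabilityMeasure P]
    (hmom : MemLp (fun w : Obs h p => w.2) 4 P) (y : Fin h) :
    invSqrt (covX P) *ᵥ covXJ P y = sliceZ P y := by
  ext i
  simp only [sliceZ, Z_apply, Finset.mul_sum]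
  have hint : ∀ a, Integrable (fun w : Obs h p => J y w *
      (invSqrt (covX P) i a * (w.2 a - meanX P a))) P := fun a =>
    integrable_mul_of_memLp_four (memLp_J P y 4) ((memLp_coord_sub hmom a).const_mul _)
  rw [integral_finsetSum _ fun a _ => hint a]
  simp only [Matrix.mulVec, dotProduct]
  refine Finset.sum_congr rfl fun a _ => ?_
  rw [covXJ_apply hmom, ← integral_const_mul]
  congr 1
  ext w
  ring

theorem beta_eq_mulVec_sliceZ {h p : ℕ} {P : Measure (Obs h p)} [IsProbabilityMeasure P]
    (hmom : MemLp (fun w : Obs h p => w.2) 4 P) (hcov : (covX P).PosDef) (y : Fin h) :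
    beta P y = invSqrt (covX P) *ᵥ sliceZ P y := by
  rw [← invSqrt_mulVec_covXJ hmom, Matrix.mulVec_mulVec, invSqrt_mul_self hcov.posSemidef]
  rfl

/-- On the `Z` scale the regression coefficient is `E(J_y Z)`, a vector that coverage will place in
the central subspace. -/
theorem eps_eq {h p : ℕ} {P : Measure (Obs h p)} [IsProbabilityMeasure P]
    (hmom : MemLp (fun w : Obs h p => w.2) 4 P) (hcov : (covX P).PosDef) (w : Obs h p)
    (y : Fin h) : eps P w y = J y w - f P y - sliceZ P y ⬝ᵥ (Z P w).ofLp := by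
  rw [eps, beta_eq_mulVec_sliceZ hmom hcov, Z_ofLp, Matrix.dotProduct_mulVec,
    ← Matrix.vecMul_transpose, transpose_invSqrt]

theorem memLp_eps {h p : ℕ} {P : Measure (Obs h p)} [IsProbabilityMeasure P]
    (hmom : MemLp (fun w : Obs h p => w.2) 4 P) (y : Fin h) :
    MemLp (fun w => eps P w y) 4 P := by
  simp only [eps, dotProduct]
  exact ((memLp_J P y 4).sub (memLp_const _)).sub
    (memLp_finsetSum _ fun a _ => (memLp_coord_sub hmom a).const_mul _)

theorem measurable_eps {h p : ℕ} (P : Measure (Obs h p)) (y : Fin h) :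
    Measurable fun w : Obs h p => eps P w y := by
  simp only [eps, dotProduct]
  have := measurable_J (p := p) y
  fun_prop

theorem integral_mul_eps {h p : ℕ} {P : Measure (Obs h p)} [IsProbabilityMeasure P]
    (hmom : MemLp (fun w : Obs h p => w.2) 4 P) (y : Fin h) {F : Obs h p → ℝ}
    (hF : MemLp F 4 P) :
    ∫ w, F w * eps P w y ∂P = ∫ w, F w * J y w ∂P - (∫ w, F w ∂P) * f P y -
      ∑ a, beta P y a * ∫ w : Obs h p, F w * (w.2 a - meanX P a) ∂P := by
  have h1 : ∀ w : Obs h p, F w * eps P w y = F w * J y w - F w * f P y -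
      ∑ a, beta P y a * (F w * (w.2 a - meanX P a)) := fun w => by
    simp only [eps, dotProduct, mul_sub, Finset.mul_sum, WithLp.ofLp_sub, Pi.sub_apply]
    congr 1
    exact Finset.sum_congr rfl fun a _ => by ring
  have i1 := integrable_mul_of_memLp_four hF (memLp_J P y 4)
  have i2 := (hF.integrable (by norm_num)).mul_const (f P y)
  have i3 : ∀ a, Integrable (fun w : Obs h p => beta P y a * (F w * (w.2 a - meanX P a))) P :=
    fun a => (integrable_mul_of_memLp_four hF (memLp_coord_sub hmom a)).const_mul _
  simp_rw [h1]
  rw [integral_sub_sub_sum i1 i2 i3, integral_mul_const]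
  simp_rw [integral_const_mul]

theorem integral_eps {h p : ℕ} {P : Measure (Obs h p)} [IsProbabilityMeasure P]
    (hmom : MemLp (fun w : Obs h p => w.2) 4 P) (y : Fin h) :
    ∫ w, eps P w y ∂P = 0 := by
  have h1 := integral_mul_eps hmom y (F := fun _ => 1) (memLp_const _)
  simpa [integral_J, integral_coord_sub hmom] using h1

/-- The normal equations `Σ β_y = Cov(X, J_y)`: the residual is orthogonal to the predictors. -/
theorem integral_coord_sub_mul_eps {h p : ℕ} {P : Measure (Obs h p)} [IsProbabilityMeasure P]
    (hmom : MemLp (fun w : Obs h p => w.2) 4 P) (hcov : (covX P).PosDef) (y : Fin h)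
    (a : Fin p) : ∫ w : Obs h p, (w.2 a - meanX P a) * eps P w y ∂P = 0 := by
  rw [integral_mul_eps hmom y (memLp_coord_sub hmom a), integral_coord_sub hmom,
    ← covXJ_apply hmom]
  simp_rw [← covX_apply hmom]
  have h1 : covX P *ᵥ beta P y = covXJ P y := by
    rw [show beta P y = (covX P)⁻¹ *ᵥ covXJ P y from rfl, Matrix.mulVec_mulVec,
      Matrix.mul_nonsing_inv _ ((Matrix.isUnit_iff_isUnit_det _).1 hcov.isUnit), Matrix.one_mulVec]
  have h2 := congrFun h1 a
  simp only [Matrix.mulVec, dotProduct] at h2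
  simp_rw [mul_comm (beta P y _)]
  rw [h2]
  ring

theorem integral_Z_mul_eps {h p : ℕ} {P : Measure (Obs h p)} [IsProbabilityMeasure P]
    (hmom : MemLp (fun w : Obs h p => w.2) 4 P) (hcov : (covX P).PosDef) (y : Fin h)
    (i : Fin p) : ∫ w : Obs h p, Z P w i * eps P w y ∂P = 0 := by
  simp_rw [Z_apply, Finset.sum_mul, mul_assoc]
  rw [integral_finsetSum _ fun a _ => (integrable_mul_of_memLp_four (memLp_coord_sub hmom a)
    (memLp_eps hmom y)).const_mul _]
  simp_rw [integral_const_mul, integral_coord_sub_mul_eps hmom hcov]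
  simp

/-! ### Covariance matrix of the residuals. -/

theorem g_mul_self {h p : ℕ} (P : Measure (Obs h p)) (y : Fin h) : g P y * g P y = f P y :=
  Real.mul_self_sqrt measureReal_nonneg

theorem g_pos {h p : ℕ} {P : Measure (Obs h p)} {y : Fin h} (hy : 0 < f P y) : 0 < g P y :=
  Real.sqrt_pos.2 hy

theorem integral_J_mul_J {h p : ℕ} (P : Measure (Obs h p)) (y z : Fin h) :
    ∫ w, J y w * J z w ∂P = if y = z then f P y else 0 := by
  split_ifs with hyz
  · rw [← integral_J]
    congr 1
    ext w
    subst hyz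
    simp [J]
  · rw [← integral_zero (Obs h p) ℝ]
    congr 1
    ext w
    simp only [J]
    split_ifs with h1 h2 <;> simp
    exact hyz (h1.symm.trans h2)

/-- `E(ε εᵀ) = D_g (Q_g - μᵀ μ) D_g`. -/
theorem integral_eps_mul_eps {h p : ℕ} {P : Measure (Obs h p)} [IsProbabilityMeasure P]
    (hmom : MemLp (fun w : Obs h p => w.2) 4 P) (hcov : (covX P).PosDef)
    (hf : ∀ y, 0 < f P y) (y z : Fin h) :
    ∫ w, eps P w y * eps P w z ∂P = g P y * Delta P y z * g P z := by
  -- Since `ε_y` is orthogonal to constants and to `Z`, only the `J_z` part of `ε_z` contributes.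
  have h1 : ∫ w, eps P w y * eps P w z ∂P = ∫ w, J z w * eps P w y ∂P := by
    have hp : ∀ w : Obs h p, eps P w y * eps P w z = J z w * eps P w y - f P z * eps P w y -
        ∑ i, sliceZ P z i * (Z P w i * eps P w y) := fun w => by
      rw [eps_eq hmom hcov w z]
      simp only [dotProduct, mul_sub, Finset.mul_sum]
      congr 1
      · ring
      · exact Finset.sum_congr rfl fun i _ => by ring
    have i1 := integrable_mul_of_memLp_four (memLp_J P z 4) (memLp_eps hmom y)
    have i2 := ((memLp_eps hmom y).integrable (by norm_num)).const_mul (f P z)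
    have i3 : ∀ i, Integrable (fun w : Obs h p => sliceZ P z i * (Z P w i * eps P w y)) P :=
      fun i => (integrable_mul_of_memLp_four (memLp_Z hmom i) (memLp_eps hmom y)).const_mul _
    simp_rw [hp]
    rw [integral_sub_sub_sum i1 i2 i3, integral_const_mul, integral_eps hmom]
    simp_rw [integral_const_mul, integral_Z_mul_eps hmom hcov]
    simp
  have h2 : ∫ w, J z w * eps P w y ∂P =
      (if y = z then f P y else 0) - f P y * f P z - sliceZ P y ⬝ᵥ sliceZ P z := by
    have hp : ∀ w : Obs h p, J z w * eps P w y = J y w * J z w - f P y * J z w -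
        ∑ i, sliceZ P y i * (J z w * Z P w i) := fun w => by
      rw [eps_eq hmom hcov w y]
      simp only [dotProduct, mul_sub, Finset.mul_sum]
      congr 1
      · ring
      · exact Finset.sum_congr rfl fun i _ => by ring
    have i1 := integrable_mul_of_memLp_four (memLp_J P y 4) (memLp_J P z 4)
    have i2 := ((memLp_J P z 4).integrable (by norm_num)).const_mul (f P y)
    have i3 : ∀ i, Integrable (fun w : Obs h p => sliceZ P y i * (J z w * Z P w i)) P :=
      fun i => (integrable_mul_of_memLp_four (memLp_J P z 4) (memLp_Z hmom i)).const_mul _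
    simp_rw [hp]
    rw [integral_sub_sub_sum i1 i2 i3, integral_const_mul, integral_J, integral_J_mul_J]
    simp_rw [integral_const_mul]
    rfl
  rw [h1, h2, sliceZ_eq_smul hmom y (hf y), sliceZ_eq_smul hmom z (hf z), ← g_mul_self P y,
    ← g_mul_self P z]
  simp only [Delta, Qg, Matrix.sub_apply, Matrix.one_apply, Matrix.vecMulVec_apply,
    Matrix.mul_apply, Matrix.transpose_apply, muMatrix, Matrix.of_apply, dotProduct, Pi.smul_apply,
    smul_eq_mul, mul_sub, sub_mul, Finset.mul_sum, Finset.sum_mul]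
  congr 1
  · congr 1
    · split_ifs with hyz
      · subst hyz; ring
      · ring
    · ring
  · exact Finset.sum_congr rfl fun i _ => by ring

/-- `Q_g - μᵀ μ` is the covariance matrix of `D_g⁻¹ ε`. -/
theorem posSemidef_Delta {h p : ℕ} {P : Measure (Obs h p)} [IsProbabilityMeasure P]
    (hmom : MemLp (fun w : Obs h p => w.2) 4 P) (hcov : (covX P).PosDef)
    (hf : ∀ y, 0 < f P y) : (Delta P).PosSemidef := by
  refine Matrix.PosSemidef.of_dotProduct_mulVec_nonneg (isHermitian_Delta P) fun x => ?_
  have hint : ∀ y z, Integrable (fun w : Obs h p => (x y * (g P y)⁻¹) * (x z * (g P z)⁻¹) *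
      (eps P w y * eps P w z)) P := fun y z =>
    (integrable_mul_of_memLp_four (memLp_eps hmom y) (memLp_eps hmom z)).const_mul _
  have h1 : star x ⬝ᵥ Delta P *ᵥ x = ∫ w, (∑ y, x y * (g P y)⁻¹ * eps P w y) ^ 2 ∂P := by
    have hp : ∀ w : Obs h p, (∑ y, x y * (g P y)⁻¹ * eps P w y) ^ 2 = ∑ y, ∑ z,
        (x y * (g P y)⁻¹) * (x z * (g P z)⁻¹) * (eps P w y * eps P w z) := fun w => by
      rw [sq, Finset.sum_mul_sum]
      exact Finset.sum_congr rfl fun y _ => Finset.sum_congr rfl fun z _ => by ring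
    simp_rw [hp]
    rw [integral_finsetSum _ fun y _ => integrable_finsetSum _ fun z _ => hint y z]
    simp only [star_trivial, dotProduct, Matrix.mulVec, Finset.mul_sum]
    refine Finset.sum_congr rfl fun y _ => ?_
    rw [integral_finsetSum _ fun z _ => hint y z]
    refine Finset.sum_congr rfl fun z _ => ?_
    rw [integral_const_mul, integral_eps_mul_eps hmom hcov hf]
    have := (g_pos (hf y)).ne'
    have := (g_pos (hf z)).ne'
    field_simp
  rw [h1]
  exact integral_nonneg fun w => sq_nonneg _

theorem sum_J {h p : ℕ} (w : Obs h p) : ∑ y, J y w = 1 := by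
  simp [J]

theorem sum_f {h p : ℕ} (P : Measure (Obs h p)) [IsProbabilityMeasure P] : ∑ y, f P y = 1 := by
  simp_rw [← integral_J]
  rw [← integral_finsetSum _ fun y _ => (memLp_J P y 1).integrable le_rfl]
  simp [sum_J]

/-- `Q_g g = 0` because `∑ f_y = 1`, and `μ g = ∑ f_y E(Z | Y = y) = E Z = 0`. -/
theorem Delta_mulVec_g {h p : ℕ} {P : Measure (Obs h p)} [IsProbabilityMeasure P]
    (hmom : MemLp (fun w : Obs h p => w.2) 4 P) (hf : ∀ y, 0 < f P y) :
    Delta P *ᵥ g P = 0 := by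
  have h1 : g P ⬝ᵥ g P = 1 := by
    simp only [dotProduct, g_mul_self, sum_f]
  have h2 : muMatrix P *ᵥ g P = 0 := by
    ext i
    have : ∀ y, muMatrix P i y * g P y = ∫ w, J y w * Z P w i ∂P := fun y => by
      change _ = sliceZ P y i
      rw [sliceZ_eq_smul hmom y (hf y), ← g_mul_self]
      simp [muMatrix]
      ring
    simp only [Matrix.mulVec, dotProduct, this]
    rw [← integral_finsetSum _ fun y _ =>
      integrable_mul_of_memLp_four (memLp_J P y 4) (memLp_Z hmom i)]
    simp_rw [← Finset.sum_mul, sum_J, one_mul]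
    exact integral_Z_apply hmom i
  rw [Delta, Matrix.sub_mulVec, ← Matrix.mulVec_mulVec, h2, Qg, Matrix.sub_mulVec,
    Matrix.vecMulVec_mulVec, h1]
  simp

theorem g_ne_zero {h p : ℕ} {P : Measure (Obs h p)} [IsProbabilityMeasure P] : g P ≠ 0 := by
  intro h0
  have h1 := sum_f P
  simp_rw [← g_mul_self, h0] at h1
  simp at h1

/-! ### Consequences of the coordinate and coverage conditions -/

theorem orthBasis_transpose_mul_self {p r : ℕ} {S : Matrix (Fin p) (Fin p) ℝ} (hS : S.PosDef)
    {αx : Matrix (Fin p) (Fin r) ℝ} (hαx : LinearIndependent ℝ αx.col) :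
    (orthBasis S αx)ᵀ * orthBasis S αx = 1 := by
  have hG := posDef_transpose_mul_inv_mul hS hαx
  rw [orthBasis, Matrix.transpose_mul, Matrix.transpose_mul, transpose_invSqrt, transpose_invSqrt,
    ← invSqrt_mul_mul_invSqrt hG]
  conv_rhs => rw [← invSqrt_mul_self hS.posSemidef]
  simp only [Matrix.mul_assoc, ← invSqrt_mul_self hS.posSemidef]

theorem orthBasis_transpose_mulVec {h p r : ℕ} {P : Measure (Obs h p)} [IsProbabilityMeasure P]
    {αx : Matrix (Fin p) (Fin r) ℝ} (hH : CoordinateHypothesis P αx)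
    {v : EuclideanSpace ℝ (Fin p)} (hv : v ∈ centralSubspace P) :
    (orthBasis (covX P) αx)ᵀ *ᵥ v.ofLp = 0 := by
  ext k
  have h1 := hH v hv
  have hmem : WithLp.toLp 2 ((orthBasis (covX P) αx).col k) ∈
      colSpan (orthBasis (covX P) αx) := Submodule.subset_span ⟨k, rfl⟩
  have h2 := Submodule.inner_starProjection_left_eq_right (colSpan (orthBasis (covX P) αx))
    (WithLp.toLp 2 ((orthBasis (covX P) αx).col k)) v
  rw [h1, inner_zero_right, Submodule.starProjection_eq_self_iff.2 hmem,
    EuclideanSpace.inner_eq_star_dotProduct] at h2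
  rw [star_trivial, dotProduct_comm] at h2
  exact h2

theorem orthBasis_transpose_mulVec_sliceZ {h p r : ℕ} {P : Measure (Obs h p)}
    [IsProbabilityMeasure P] (hmom : MemLp (fun w : Obs h p => w.2) 4 P)
    (hf : ∀ y, 0 < f P y) {αx : Matrix (Fin p) (Fin r) ℝ} (hH : CoordinateHypothesis P αx)
    (hcover : Coverage P) (y : Fin h) :
    (orthBasis (covX P) αx)ᵀ *ᵥ sliceZ P y = 0 := by
  rw [sliceZ_eq_smul hmom y (hf y), Matrix.mulVec_smul, orthBasis_transpose_mulVec hH, smul_zero]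
  rw [← hcover]
  exact Submodule.subset_span ⟨y, rfl⟩

/-- With `G = α_xᵀ Σ⁻¹ α_x`, `αᵀ E(J_y Z) = G^{-1/2} α_xᵀ β_y`. The left side vanishes since `E(J_y
Z)` lies in the central subspace, and `G^{-1/2}` is invertible. -/
theorem transpose_mulVec_beta {h p r : ℕ} {P : Measure (Obs h p)}
    [IsProbabilityMeasure P] (hmom : MemLp (fun w : Obs h p => w.2) 4 P)
    (hcov : (covX P).PosDef) (hf : ∀ y, 0 < f P y) {αx : Matrix (Fin p) (Fin r) ℝ}
    (hαx : LinearIndependent ℝ αx.col) (hH : CoordinateHypothesis P αx)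
    (hcover : Coverage P) (y : Fin h) : αxᵀ *ᵥ beta P y = 0 := by
  have hG := posDef_transpose_mul_inv_mul hcov hαx
  set G := αxᵀ * (covX P)⁻¹ * αx with hGdef
  have h1 := orthBasis_transpose_mulVec_sliceZ hmom hf hH hcover y
  rw [orthBasis, Matrix.transpose_mul, Matrix.transpose_mul, transpose_invSqrt, transpose_invSqrt,
    ← Matrix.mulVec_mulVec, ← Matrix.mulVec_mulVec, ← beta_eq_mulVec_sliceZ hmom hcov] at h1
  have h2 : G * invSqrt G * invSqrt G = 1 := by
    rw [Matrix.mul_assoc, invSqrt_mul_self hG.posSemidef,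
      Matrix.mul_nonsing_inv _ ((Matrix.isUnit_iff_isUnit_det _).1 hG.isUnit)]
  rw [← Matrix.one_mulVec (αxᵀ *ᵥ beta P y), ← h2, ← Matrix.mulVec_mulVec, h1, Matrix.mulVec_zero]

/-! ### Conditional independence -/

/-- If `X` and `Y` are conditionally independent given `m`, and `m` is coarser than `σ(Y)`, then
conditioning an event about `X` on `Y` is the same as conditioning it on `m`. -/
theorem condExp_comap_eq_of_condIndepFun {Ω β γ : Type*} {m : MeasurableSpace Ω}
    [mΩ : MeasurableSpace Ω] [StandardBorelSpace Ω] [MeasurableSpace β] [mγ : MeasurableSpace γ] {μ : Measure Ω}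
    [IsFiniteMeasure μ] {hm : m ≤ mΩ} {X : Ω → β} {Y : Ω → γ}
    (hX : Measurable X) (hY : Measurable Y) (hmY : m ≤ mγ.comap Y)
    (hXY : CondIndepFun m hm X Y μ) {s : Set β} (hs : MeasurableSet s) :
    μ[(X ⁻¹' s).indicator (fun _ => (1 : ℝ)) | mγ.comap Y] =ᵐ[μ]
      μ[(X ⁻¹' s).indicator (fun _ => (1 : ℝ)) | m] := by
  have hA : MeasurableSet (X ⁻¹' s) := hX hs
  set A : Ω → ℝ := (X ⁻¹' s).indicator (fun _ => (1 : ℝ)) with hAdef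
  have hAint : Integrable A μ := (integrable_const 1).indicator hA
  symm
  refine ae_eq_condExp_of_forall_setIntegral_eq hY.comap_le hAint
    (fun _ _ _ => integrable_condExp.integrableOn) ?_
    (stronglyMeasurable_condExp.mono hmY).aestronglyMeasurable
  rintro _ ⟨t, ht, rfl⟩ -
  have hB : MeasurableSet (Y ⁻¹' t) := hY ht
  set B : Ω → ℝ := (Y ⁻¹' t).indicator (fun _ => (1 : ℝ)) with hBdef
  have hBint : Integrable B μ := (integrable_const 1).indicator hB
  have hmul : ∀ F : Ω → ℝ, (Y ⁻¹' t).indicator F = F * B := fun F => by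
    ext ω; by_cases h : ω ∈ Y ⁻¹' t <;> simp [hBdef, h]
  have hint : Integrable (μ[A | m] * B) μ := by
    rw [← hmul]; exact integrable_condExp.indicator hB
  have hci := (condIndepFun_iff_condExp_inter_preimage_eq_mul hX hY).1 hXY s t hs ht
  have hAB : (Y ⁻¹' t).indicator A = (X ⁻¹' s ∩ Y ⁻¹' t).indicator (fun _ => (1 : ℝ)) := by
    rw [hAdef, Set.indicator_indicator, Set.inter_comm]
  -- Conditioning on `m` turns `E(A | m) B` into `E(A | m) E(B | m)`, which conditional independence
  -- identifies with the conditional probability of the intersection.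
  calc ∫ ω in Y ⁻¹' t, μ[A | m] ω ∂μ = ∫ ω, (μ[A | m] * B) ω ∂μ := by
        rw [← integral_indicator hB, hmul]
    _ = ∫ ω, μ[A | m] ω * μ[B | m] ω ∂μ := by
        rw [← integral_condExp hm]
        exact integral_congr_ae
          (condExp_mul_of_stronglyMeasurable_left stronglyMeasurable_condExp hint hBint)
    _ = ∫ ω, μ[(X ⁻¹' s ∩ Y ⁻¹' t).indicator (fun _ => (1 : ℝ)) | m] ω ∂μ :=
        (integral_congr_ae hci).symm
    _ = ∫ ω in Y ⁻¹' t, A ω ∂μ := by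
        rw [integral_condExp hm, ← integral_indicator hB, hAB]

/-- Condition first on `Y`, where the event about `X` may be replaced by its `m`-conditional
probability, and then on `m`, where only `q` remains to be averaged. Here `φ` and `q` may be
unbounded. -/
theorem integral_indicator_mul_of_condIndepFun {Ω β γ : Type*} {m : MeasurableSpace Ω}
    [mΩ : MeasurableSpace Ω] [StandardBorelSpace Ω] [MeasurableSpace β] [mγ : MeasurableSpace γ] {μ : Measure Ω}
    [IsFiniteMeasure μ] {hm : m ≤ mΩ} {X : Ω → β} {Y : Ω → γ}
    (hX : Measurable X) (hY : Measurable Y) (hmY : m ≤ mγ.comap Y)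
    (hXY : CondIndepFun m hm X Y μ) {s : Set β} (hs : MeasurableSet s) {φ q : Ω → ℝ}
    (hφ : StronglyMeasurable[m] φ) (hq : StronglyMeasurable[mγ.comap Y] q)
    (hφi : Integrable φ μ) (hqi : Integrable q μ) (hφq : Integrable (φ * q) μ) {c : ℝ}
    (hc : μ[q | m] =ᵐ[μ] fun _ => c) :
    ∫ ω, (X ⁻¹' s).indicator (fun _ => (1 : ℝ)) ω * (φ ω * q ω) ∂μ =
      c * ∫ ω, (X ⁻¹' s).indicator (fun _ => (1 : ℝ)) ω * φ ω ∂μ := by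
  have hA : MeasurableSet (X ⁻¹' s) := hX hs
  have hci := condExp_comap_eq_of_condIndepFun hX hY hmY hXY hs
  set A : Ω → ℝ := (X ⁻¹' s).indicator (fun _ => (1 : ℝ)) with hAdef
  have hAint : Integrable A μ := (integrable_const 1).indicator hA
  have hmul : ∀ F : Ω → ℝ, (X ⁻¹' s).indicator F = F * A := fun F => by
    ext ω; by_cases h : ω ∈ X ⁻¹' s <;> simp [hAdef, h]
  have hi1 : Integrable (φ * q * A) μ := by rw [← hmul]; exact hφq.indicator hA
  have hi2 : Integrable (φ * A) μ := by rw [← hmul]; exact hφi.indicator hA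
  have h1 : μ[φ * q * A | mγ.comap Y] =ᵐ[μ] (φ * μ[A | m]) * q := by
    filter_upwards [condExp_mul_of_stronglyMeasurable_left ((hφ.mono hmY).mul hq) hi1 hAint, hci]
      with ω h1 h2
    rw [h1]
    simp only [Pi.mul_apply, h2]
    ring
  -- Integrability is inherited from the conditional expectation in `h1`, to which this product is
  -- a.e. equal.
  have hi3 : Integrable ((φ * μ[A | m]) * q) μ := integrable_condExp.congr h1
  have h2 := condExp_mul_of_stronglyMeasurable_left (hφ.mul stronglyMeasurable_condExp) hi3 hqi
  have h3 := condExp_mul_of_stronglyMeasurable_left hφ hi2 hAint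
  calc ∫ ω, A ω * (φ ω * q ω) ∂μ = ∫ ω, (φ * q * A) ω ∂μ := by
        congr 1; ext ω; simp only [Pi.mul_apply]; ring
    _ = ∫ ω, ((φ * μ[A | m]) * q) ω ∂μ := by
        rw [← integral_condExp hY.comap_le, integral_congr_ae h1]
    _ = ∫ ω, c * μ[φ * A | m] ω ∂μ := by
        rw [← integral_condExp hm, integral_congr_ae h2]
        refine integral_congr_ae ?_
        filter_upwards [hc, h3] with ω h4 h5
        rw [h5]
        simp only [Pi.mul_apply, h4]
        ring
    _ = c * ∫ ω, A ω * φ ω ∂μ := by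
        rw [integral_const_mul, integral_condExp hm]
        congr 2; ext ω; simp only [Pi.mul_apply]; ring

/-! ### The covariance matrix `Ω_H` -/

/-- `αᵀ Z`. -/
def alphaZ {h p r : ℕ} (P : Measure (Obs h p)) (αx : Matrix (Fin p) (Fin r) ℝ) (w : Obs h p) :
    Fin r → ℝ :=
  (orthBasis (covX P) αx)ᵀ *ᵥ (Z P w).ofLp

theorem memLp_alphaZ {h p r : ℕ} {P : Measure (Obs h p)} [IsProbabilityMeasure P]
    (hmom : MemLp (fun w : Obs h p => w.2) 4 P) (αx : Matrix (Fin p) (Fin r) ℝ) (k : Fin r) :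
    MemLp (fun w => alphaZ P αx w k) 4 P := by
  simp only [alphaZ, Matrix.mulVec, dotProduct]
  exact memLp_finsetSum _ fun i _ => (memLp_Z hmom i).const_mul _

theorem memLp_projZ {h p : ℕ} {P : Measure (Obs h p)} [IsProbabilityMeasure P]
    (hmom : MemLp (fun w : Obs h p => w.2) 4 P) (S : Submodule ℝ (EuclideanSpace ℝ (Fin p)))
    (i : Fin p) : MemLp (fun w => projZ P S w i) 4 P := by
  have h1 : MemLp (fun w : Obs h p => w.2 - meanX P) 4 P := hmom.sub (memLp_const _)
  exact (EuclideanSpace.proj (𝕜 := ℝ) i ∘L S.starProjection ∘L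
    Matrix.toEuclideanCLM (𝕜 := ℝ) (invSqrt (covX P))).comp_memLp' h1

theorem sigmaProjZ_le_comap_Z {h p : ℕ} (P : Measure (Obs h p))
    (S : Submodule ℝ (EuclideanSpace ℝ (Fin p))) :
    sigmaProjZ P S ≤ MeasurableSpace.comap (Z P) inferInstance := by
  have h1 : projZ P S = S.starProjection ∘ Z P := rfl
  rw [sigmaProjZ, h1, ← MeasurableSpace.comap_comp]
  exact MeasurableSpace.comap_mono S.starProjection.measurable.comap_le

/-- Under the coordinate, linearity and constant covariance conditions,
`E(αᵀ Z Zᵀ α | P_S Z) = I`. -/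
theorem condExp_alphaZ_mul_alphaZ {h p r : ℕ} {P : Measure (Obs h p)} [IsProbabilityMeasure P]
    (hmom : MemLp (fun w : Obs h p => w.2) 4 P) (hcov : (covX P).PosDef)
    {αx : Matrix (Fin p) (Fin r) ℝ} (hαx : LinearIndependent ℝ αx.col)
    (hH : CoordinateHypothesis P αx) (hlin : Linearity P) (hconst : ConstantCovariance P)
    (k l : Fin r) :
    P[fun w => alphaZ P αx w k * alphaZ P αx w l | sigmaProjZ P (centralSubspace P)] =ᵐ[P]
      fun _ => (1 : Matrix (Fin r) (Fin r) ℝ) k l := by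
  set S := centralSubspace P with hS
  set α := orthBasis (covX P) αx with hα
  let R : Fin p → Obs h p → ℝ := fun i w => Z P w i - projZ P S w i
  have hR4 : ∀ i, MemLp (R i) 4 P := fun i => (memLp_Z hmom i).sub (memLp_projZ hmom S i)
  -- Linearity replaces the conditional mean in the conditional covariance by `P_S Z`.
  have hRR : ∀ i j, P[fun w => R i w * R j w | sigmaProjZ P S] =ᵐ[P]
      fun _ => (1 - projMatrix S) i j := fun i j => by
    refine EventuallyEq.trans (condExp_congr_ae ?_) (hconst i j)
    filter_upwards [hlin] with w hw
    rw [hw]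
  -- The coordinate hypothesis gives `αᵀ P_S = 0`, hence `αᵀ Z = αᵀ (Z - P_S Z)`, and `αᵀ (I - P_S)
  -- α = αᵀ α = I`.
  have hproj : ∀ v : EuclideanSpace ℝ (Fin p), αᵀ *ᵥ (S.starProjection v).ofLp = 0 := fun v =>
    orthBasis_transpose_mulVec hH (S.starProjection_apply_mem v)
  have hαR : ∀ w k, alphaZ P αx w k = ∑ i, α i k * R i w := fun w k => by
    have h1 := congrFun (hproj (Z P w)) k
    have h2 : alphaZ P αx w k = alphaZ P αx w k - (αᵀ *ᵥ (S.starProjection (Z P w)).ofLp) k := by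
      rw [h1]; simp
    rw [h2]
    simp only [alphaZ, ← hα, Matrix.mulVec, dotProduct, Matrix.transpose_apply, R, mul_sub,
      Finset.sum_sub_distrib]
    rfl
  have hq : (fun w => alphaZ P αx w k * alphaZ P αx w l) =
      ∑ a : Fin p × Fin p, (α a.1 k * α a.2 l) • fun w => R a.1 w * R a.2 w := by
    ext w
    rw [hαR, hαR, Finset.sum_mul_sum, Finset.sum_apply, Fintype.sum_prod_type]
    refine Finset.sum_congr rfl fun i _ => Finset.sum_congr rfl fun j _ => ?_
    simp only [Pi.smul_apply, smul_eq_mul]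
    ring
  have h1 : ∑ a : Fin p × Fin p, (α a.1 k * α a.2 l) * (1 - projMatrix S) a.1 a.2 =
      (1 : Matrix (Fin r) (Fin r) ℝ) k l := by
    have h2 : αᵀ * projMatrix S = 0 := by
      ext k j
      exact congrFun (hproj (EuclideanSpace.single j 1)) k
    have h3 : αᵀ * (1 - projMatrix S) * α = 1 := by
      rw [Matrix.mul_sub, h2, sub_zero, Matrix.mul_one, orthBasis_transpose_mul_self hcov hαx]
    rw [← h3, Matrix.mul_apply, Fintype.sum_prod_type, Finset.sum_comm]
    refine Finset.sum_congr rfl fun j _ => ?_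
    rw [Matrix.mul_apply, Finset.sum_mul]
    refine Finset.sum_congr rfl fun i _ => ?_
    rw [Matrix.transpose_apply]
    ring
  rw [hq]
  refine (condExp_finsetSum (fun a _ =>
    (integrable_mul_of_memLp_four (hR4 a.1) (hR4 a.2)).smul _) _).trans ?_
  have h4 : ∀ᵐ w ∂P, ∀ a : Fin p × Fin p,
      P[(α a.1 k * α a.2 l) • fun w => R a.1 w * R a.2 w | sigmaProjZ P S] w =
        (α a.1 k * α a.2 l) * (1 - projMatrix S) a.1 a.2 := by
    rw [ae_all_iff]
    intro a
    filter_upwards [condExp_smul (μ := P) (α a.1 k * α a.2 l) (fun w => R a.1 w * R a.2 w)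
      (sigmaProjZ P S), hRR a.1 a.2] with w h5 h6
    rw [h5, Pi.smul_apply, h6, smul_eq_mul]
  filter_upwards [h4] with w hw
  rw [Finset.sum_apply, ← h1]
  exact Finset.sum_congr rfl fun a _ => hw a

theorem integral_eps_mul_eps_mul_alphaZ {h p r : ℕ} {P : Measure (Obs h p)}
    [IsProbabilityMeasure P]
    (hmom : MemLp (fun w : Obs h p => w.2) 4 P) (hcov : (covX P).PosDef)
    (hf : ∀ y, 0 < f P y) (hcs : CentralSubspaceExists P)
    {αx : Matrix (Fin p) (Fin r) ℝ} (hαx : LinearIndependent ℝ αx.col)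
    (hH : CoordinateHypothesis P αx) (hlin : Linearity P) (hcover : Coverage P)
    (hconst : ConstantCovariance P) (y z : Fin h) (k l : Fin r) :
    ∫ w, (eps P w y * eps P w z) * (alphaZ P αx w k * alphaZ P αx w l) ∂P =
      (1 : Matrix (Fin r) (Fin r) ℝ) k l * ∫ w, eps P w y * eps P w z ∂P := by
  set S := centralSubspace P with hS
  -- `ε_y` on the slice `c`
  let e : Fin h → Fin h → Obs h p → ℝ := fun c y w =>
    (if c = y then 1 else 0) - f P y - sliceZ P y ⬝ᵥ (Z P w).ofLp
  have he4 : ∀ c y, MemLp (e c y) 4 P := fun c y => by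
    simp only [e, dotProduct]
    exact ((memLp_const _).sub (memLp_const _)).sub
      (memLp_finsetSum _ fun i _ => (memLp_Z hmom i).const_mul _)
  -- By coverage `E(J_y Z) ∈ S`, so its inner product with `Z` depends on `P_S Z` only.
  have hem : ∀ c y, StronglyMeasurable[sigmaProjZ P S] (e c y) := fun c y => by
    have hmem : WithLp.toLp 2 (sliceZ P y) ∈ S := by
      rw [sliceZ_eq_smul hmom y (hf y), hS, ← hcover]
      exact Submodule.smul_mem _ _ (Submodule.subset_span ⟨y, rfl⟩)
    have h1 : e c y = fun w => (if c = y then 1 else 0) - f P y -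
        inner ℝ (WithLp.toLp 2 (sliceZ P y)) (projZ P S w) := by
      ext w
      rw [projZ, ← Submodule.inner_starProjection_left_eq_right,
        Submodule.starProjection_eq_self_iff.2 hmem, EuclideanSpace.inner_eq_star_dotProduct,
        star_trivial, dotProduct_comm]
    have h2 : Measurable fun v : EuclideanSpace ℝ (Fin p) => (if c = y then (1 : ℝ) else 0) - f P y -
        inner ℝ (WithLp.toLp 2 (sliceZ P y)) v := by fun_prop
    rw [h1]
    exact (h2.comp (comap_measurable (projZ P S))).stronglyMeasurable
  have hqm : StronglyMeasurable[MeasurableSpace.comap (Z P) inferInstance]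
      fun w => alphaZ P αx w k * alphaZ P αx w l := by
    have h2 : Measurable fun v : EuclideanSpace ℝ (Fin p) =>
        ((orthBasis (covX P) αx)ᵀ *ᵥ v.ofLp) k * ((orthBasis (covX P) αx)ᵀ *ᵥ v.ofLp) l := by
      simp only [Matrix.mulVec, dotProduct]
      fun_prop
    exact (h2.comp (comap_measurable (Z P))).stronglyMeasurable
  have hee : ∀ c, MemLp (fun w => e c y w * e c z w) 2 P := fun c =>
    memLp_mul_two (he4 c y) (he4 c z)
  have hqq : MemLp (fun w => alphaZ P αx w k * alphaZ P αx w l) 2 P :=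
    memLp_mul_two (memLp_alphaZ hmom αx k) (memLp_alphaZ hmom αx l)
  -- With the label fixed at `c`, the residuals no longer involve `Y`; its only trace is the
  -- indicator `J c`.
  have hsplit : ∀ w, eps P w y * eps P w z = ∑ c, J c w * (e c y w * e c z w) := fun w => by
    simp [J, e, eps_eq hmom hcov]
  have hJ : ∀ c, (fun w : Obs h p => w.1) ⁻¹' {c} = {w : Obs h p | w.1 = c} := fun c => rfl
  have hint : ∀ c, Integrable (fun w => J c w * ((e c y w * e c z w) *
      (alphaZ P αx w k * alphaZ P αx w l))) P := fun c => by
    rw [J_eq_indicator]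
    refine (((hee c).integrable_mul hqq).indicator (measurableSet_slice c)).congr
      (.of_forall fun w => ?_)
    simp [Set.indicator_apply]
  have hint2 : ∀ c, Integrable (fun w => J c w * (e c y w * e c z w)) P := fun c =>
    MemLp.integrable_mul (memLp_J P c 2) (hee c)
  simp_rw [hsplit, Finset.sum_mul, mul_assoc (J _ _)]
  rw [integral_finsetSum _ fun c _ => hint c, integral_finsetSum _ fun c _ => hint2 c,
    Finset.mul_sum]
  refine Finset.sum_congr rfl fun c _ => ?_
  rw [J_eq_indicator, ← hJ]
  exact integral_indicator_mul_of_condIndepFun (m := sigmaProjZ P S) (hm := sigmaProjZ_le P S)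
    measurable_fst (measurable_Z P)
    (sigmaProjZ_le_comap_Z P S) hcs (measurableSet_singleton c) ((hem c y).mul (hem c z)) hqm
    ((hee c).integrable (by norm_num)) (hqq.integrable (by norm_num)) ((hee c).integrable_mul hqq)
    (condExp_alphaZ_mul_alphaZ hmom hcov hαx hH hlin hconst k l)

/-- `D_g⁻¹ ε ⊗ αᵀ Z`. -/
def residVec {h p r : ℕ} (P : Measure (Obs h p)) (αx : Matrix (Fin p) (Fin r) ℝ) (w : Obs h p)
    (a : Fin h × Fin r) : ℝ :=
  (g P a.1)⁻¹ * eps P w a.1 * alphaZ P αx w a.2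

theorem memLp_residVec {h p r : ℕ} {P : Measure (Obs h p)} [IsProbabilityMeasure P]
    (hmom : MemLp (fun w : Obs h p => w.2) 4 P) (αx : Matrix (Fin p) (Fin r) ℝ)
    (a : Fin h × Fin r) : MemLp (fun w => residVec P αx w a) 2 P :=
  memLp_mul_two ((memLp_eps hmom a.1).const_mul _) (memLp_alphaZ hmom αx a.2)

theorem integral_residVec_mul_residVec {h p r : ℕ} {P : Measure (Obs h p)}
    [IsProbabilityMeasure P]
    (hmom : MemLp (fun w : Obs h p => w.2) 4 P) (hcov : (covX P).PosDef)
    (hf : ∀ y, 0 < f P y) (hcs : CentralSubspaceExists P)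
    {αx : Matrix (Fin p) (Fin r) ℝ} (hαx : LinearIndependent ℝ αx.col)
    (hH : CoordinateHypothesis P αx) (hlin : Linearity P) (hcover : Coverage P)
    (hconst : ConstantCovariance P) (a b : Fin h × Fin r) :
    ∫ w, residVec P αx w a * residVec P αx w b ∂P =
      (Delta P ⊗ₖ (1 : Matrix (Fin r) (Fin r) ℝ)) a b := by
  have h1 : ∀ w, residVec P αx w a * residVec P αx w b = (g P a.1)⁻¹ * (g P b.1)⁻¹ *
      ((eps P w a.1 * eps P w b.1) * (alphaZ P αx w a.2 * alphaZ P αx w b.2)) := fun w => by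
    simp only [residVec]; ring
  simp_rw [h1]
  rw [integral_const_mul, integral_eps_mul_eps_mul_alphaZ hmom hcov hf hcs hαx hH hlin hcover
    hconst, integral_eps_mul_eps hmom hcov hf, Matrix.kronecker_apply]
  have := (g_pos (hf a.1)).ne'
  have := (g_pos (hf b.1)).ne'
  field_simp

theorem Omega_apply {h p r : ℕ} {P : Measure (Obs h p)} (hf : ∀ y, 0 < f P y)
    (αx : Matrix (Fin p) (Fin r) ℝ) (a b : Fin h × Fin r) :
    Omega P αx a b = ∫ w, residVec P αx w a * residVec P αx w b ∂P := by
  have hinv : (Matrix.diagonal (g P))⁻¹ = Matrix.diagonal fun y => (g P y)⁻¹ := by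
    refine Matrix.inv_eq_right_inv ?_
    rw [Matrix.diagonal_mul_diagonal, ← Matrix.diagonal_one]
    congr 1
    ext y
    exact mul_inv_cancel₀ (g_pos (hf y)).ne'
  simp only [Omega, Matrix.of_apply, hinv]
  congr 1
  ext w
  rw [Matrix.kronecker_apply, Matrix.mul_diagonal, Matrix.diagonal_mul, Matrix.vecMulVec_apply,
    Matrix.mul_vecMulVec, Matrix.vecMulVec_mul, Matrix.vecMulVec_apply, ← Matrix.mulVec_transpose]
  simp only [residVec, alphaZ]
  ring

theorem Omega_eq {h p r : ℕ} {P : Measure (Obs h p)}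
    [IsProbabilityMeasure P]
    (hmom : MemLp (fun w : Obs h p => w.2) 4 P) (hcov : (covX P).PosDef)
    (hf : ∀ y, 0 < f P y) (hcs : CentralSubspaceExists P)
    {αx : Matrix (Fin p) (Fin r) ℝ} (hαx : LinearIndependent ℝ αx.col)
    (hH : CoordinateHypothesis P αx) (hlin : Linearity P) (hcover : Coverage P)
    (hconst : ConstantCovariance P) :
    Omega P αx = Delta P ⊗ₖ (1 : Matrix (Fin r) (Fin r) ℝ) := by
  ext a b
  rw [Omega_apply hf, integral_residVec_mul_residVec hmom hcov hf hcs hαx hH hlin hcover hconst]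

theorem integral_sum_residVec_sq {h p r : ℕ} {P : Measure (Obs h p)}
    [IsProbabilityMeasure P]
    (hmom : MemLp (fun w : Obs h p => w.2) 4 P) (hcov : (covX P).PosDef)
    (hf : ∀ y, 0 < f P y) (hcs : CentralSubspaceExists P)
    {αx : Matrix (Fin p) (Fin r) ℝ} (hαx : LinearIndependent ℝ αx.col)
    (hH : CoordinateHypothesis P αx) (hlin : Linearity P) (hcover : Coverage P)
    (hconst : ConstantCovariance P) (t : Fin h × Fin r → ℝ) :
    ∫ w, (∑ a, residVec P αx w a * t a) ^ 2 ∂P =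
      ∑ k, (fun y => t (y, k)) ⬝ᵥ Delta P *ᵥ fun y => t (y, k) := by
  have h1 : ∀ w, (∑ a, residVec P αx w a * t a) ^ 2 =
      ∑ a, ∑ b, t a * t b * (residVec P αx w a * residVec P αx w b) := fun w => by
    rw [sq, Finset.sum_mul_sum]
    exact Finset.sum_congr rfl fun a _ => Finset.sum_congr rfl fun b _ => by ring
  have hint : ∀ a b, Integrable (fun w => t a * t b *
      (residVec P αx w a * residVec P αx w b)) P := fun a b =>
    ((memLp_residVec hmom αx a).integrable_mul (memLp_residVec hmom αx b)).const_mul _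
  simp_rw [h1]
  rw [integral_finsetSum _ fun a _ => integrable_finsetSum _ fun b _ => hint a b,
    Fintype.sum_prod_type, Finset.sum_comm]
  refine Finset.sum_congr rfl fun k _ => ?_
  simp only [dotProduct, Matrix.mulVec, Finset.mul_sum]
  refine Finset.sum_congr rfl fun y _ => ?_
  rw [integral_finsetSum _ fun b _ => hint _ b, Fintype.sum_prod_type]
  refine Finset.sum_congr rfl fun z _ => ?_
  simp_rw [integral_const_mul,
    integral_residVec_mul_residVec hmom hcov hf hcs hαx hH hlin hcover hconst,
    Matrix.kronecker_apply, Matrix.one_apply]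
  simp
  ring

/-! ### Regularity of the matrix inverse -/

theorem measurable_det {α : Type*} [MeasurableSpace α] {m : ℕ} {M : α → Matrix (Fin m) (Fin m) ℝ}
    (hM : ∀ a b, Measurable fun x => M x a b) : Measurable fun x => (M x).det := by
  simp only [Matrix.det_apply]
  exact Finset.measurable_fun_sum _ fun σ _ =>
    (Finset.measurable_fun_prod _ fun i _ => hM _ _).const_smul (Equiv.Perm.sign σ)

/-- Cramer's formula with `0⁻¹ = 0` is measurable everywhere, so singular matrices need no separate
treatment. -/
theorem measurable_inv_apply {α : Type*} [MeasurableSpace α] {m : ℕ}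
    {M : α → Matrix (Fin m) (Fin m) ℝ} (hM : ∀ a b, Measurable fun x => M x a b) (a b : Fin m) :
    Measurable fun x => (M x)⁻¹ a b := by
  simp only [Matrix.inv_def, Ring.inverse_eq_inv', Matrix.smul_apply, smul_eq_mul,
    Matrix.adjugate_apply]
  refine (measurable_det hM).inv.mul (measurable_det fun i j => ?_)
  simp only [Matrix.updateRow_apply]
  split_ifs
  · exact measurable_const
  · exact hM i j

theorem measurable_mul_apply {α : Type*} [MeasurableSpace α] {l m n : ℕ}
    {M : α → Matrix (Fin l) (Fin m) ℝ} {N : α → Matrix (Fin m) (Fin n) ℝ}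
    (hM : ∀ a b, Measurable fun x => M x a b) (hN : ∀ a b, Measurable fun x => N x a b)
    (a : Fin l) (b : Fin n) : Measurable fun x => (M x * N x) a b := by
  simp only [Matrix.mul_apply]
  exact Finset.measurable_fun_sum _ fun i _ => (hM a i).mul (hN i b)

theorem measurable_coefForm_apply {α : Type*} [MeasurableSpace α] {p r : ℕ}
    (αx : Matrix (Fin p) (Fin r) ℝ) {M : α → Matrix (Fin p) (Fin p) ℝ}
    (hM : ∀ a b, Measurable fun x => M x a b) (a b : Fin p) :
    Measurable fun x => coefForm αx (M x) a b := by
  have h1 := measurable_inv_apply hM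
  have h2 := measurable_mul_apply (M := fun _ => αxᵀ) (fun _ _ => measurable_const) h1
  have h3 := measurable_mul_apply (N := fun _ => αx) h1 (fun _ _ => measurable_const)
  have h4 := measurable_mul_apply (N := fun _ => αx) h2 (fun _ _ => measurable_const)
  exact measurable_mul_apply (measurable_mul_apply h3 (measurable_inv_apply h4)) h2 a b

theorem tendsto_matrix_inv {α : Type*} {l : Filter α} {m : ℕ} {M : α → Matrix (Fin m) (Fin m) ℝ}
    {A : Matrix (Fin m) (Fin m) ℝ} (hM : Tendsto M l (𝓝 A)) (hA : IsUnit A) :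
    Tendsto (fun x => (M x)⁻¹) l (𝓝 A⁻¹) := by
  have hd : A.det ≠ 0 := ((Matrix.isUnit_iff_isUnit_det _).1 hA).ne_zero
  simp only [Matrix.inv_def, Ring.inverse_eq_inv']
  have h1 : Continuous fun B : Matrix (Fin m) (Fin m) ℝ => B.det := continuous_id.matrix_det
  have h2 : Continuous fun B : Matrix (Fin m) (Fin m) ℝ => B.adjugate :=
    continuous_id.matrix_adjugate
  exact (((h1.tendsto A).comp hM).inv₀ hd).smul ((h2.tendsto A).comp hM)

theorem tendsto_matrix_mul {α : Type*} {l : Filter α} {m n q : ℕ}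
    {M : α → Matrix (Fin m) (Fin n) ℝ} {N : α → Matrix (Fin n) (Fin q) ℝ}
    {A : Matrix (Fin m) (Fin n) ℝ} {B : Matrix (Fin n) (Fin q) ℝ} (hM : Tendsto M l (𝓝 A))
    (hN : Tendsto N l (𝓝 B)) : Tendsto (fun x => M x * N x) l (𝓝 (A * B)) :=
  ((continuous_fst.matrix_mul continuous_snd).tendsto (A, B)).comp (hM.prodMk_nhds hN)

theorem tendsto_coefForm {α : Type*} {l : Filter α} {p r : ℕ} {αx : Matrix (Fin p) (Fin r) ℝ}
    (hαx : LinearIndependent ℝ αx.col) {M : α → Matrix (Fin p) (Fin p) ℝ}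
    {A : Matrix (Fin p) (Fin p) ℝ} (hM : Tendsto M l (𝓝 A)) (hA : A.PosDef) :
    Tendsto (fun x => coefForm αx (M x)) l (𝓝 (coefForm αx A)) := by
  have h1 := tendsto_matrix_inv hM hA.isUnit
  have h2 := tendsto_matrix_mul (tendsto_const_nhds (x := αxᵀ)) h1
  have h3 := tendsto_matrix_inv (tendsto_matrix_mul h2 (tendsto_const_nhds (x := αx)))
    (posDef_transpose_mul_inv_mul hA hαx).isUnit
  exact tendsto_matrix_mul
    (tendsto_matrix_mul (tendsto_matrix_mul h1 (tendsto_const_nhds (x := αx))) h3) h2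

/-! ### Laws of large numbers -/

theorem tendsto_avg {h p : ℕ} {P : Measure (Obs h p)} {Ω : Type*} [MeasurableSpace Ω]
    {ν : Measure Ω} {D : ℕ → Ω → Obs h p} (hlaw : ∀ i, HasLaw (D i) P ν)
    (hindep : iIndepFun D ν) {F : Obs h p → ℝ} (hF : Measurable F) (hFi : Integrable F P) :
    ∀ᵐ ω ∂ν, Tendsto (fun n : ℕ => avg (fun i : Fin n => D i ω) F) atTop (𝓝 (∫ w, F w ∂P)) := by
  have h1 := strong_law_ae (μ := ν) (fun i ω => F (D i ω))
    ((integrable_map_measure (by rw [(hlaw 0).map_eq]; exact hFi.aestronglyMeasurable)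
      (hlaw 0).aemeasurable).1 (by rw [(hlaw 0).map_eq]; exact hFi))
    (fun i j hij => (hindep.indepFun hij).comp hF hF)
    (fun i => ((hlaw i).identDistrib (hlaw 0)).comp hF)
  have h2 : ∫ ω, F (D 0 ω) ∂ν = ∫ w, F w ∂P :=
    (hlaw 0).integral_comp hFi.aestronglyMeasurable
  filter_upwards [h1] with ω hω
  rw [← h2]
  refine hω.congr fun n => ?_
  rw [avg, Fin.sum_univ_eq_sum_range (fun k => F (D k ω)) n, smul_eq_mul]

theorem tendsto_covHat {h p : ℕ} {P : Measure (Obs h p)} [IsProbabilityMeasure P]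
    (hmom : MemLp (fun w : Obs h p => w.2) 4 P) {Ω : Type*} [MeasurableSpace Ω]
    {ν : Measure Ω} {D : ℕ → Ω → Obs h p} (hlaw : ∀ i, HasLaw (D i) P ν)
    (hindep : iIndepFun D ν) :
    ∀ᵐ ω ∂ν, Tendsto (fun n : ℕ => covHat fun i : Fin n => D i ω) atTop (𝓝 (covX P)) := by
  have h1 : ∀ a, ∀ᵐ ω ∂ν, Tendsto
      (fun n : ℕ => avg (fun i : Fin n => D i ω) fun w => w.2 a) atTop
      (𝓝 (∫ w : Obs h p, w.2 a ∂P)) := fun a =>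
    tendsto_avg hlaw hindep (by fun_prop) ((memLp_coord hmom a).integrable (by norm_num))
  have h2 : ∀ a b, ∀ᵐ ω ∂ν, Tendsto
      (fun n : ℕ => avg (fun i : Fin n => D i ω) fun w => w.2 a * w.2 b) atTop
      (𝓝 (∫ w : Obs h p, w.2 a * w.2 b ∂P)) := fun a b =>
    tendsto_avg hlaw hindep (by fun_prop)
      (integrable_mul_of_memLp_four (memLp_coord hmom a) (memLp_coord hmom b))
  filter_upwards [ae_all_iff.2 h1, ae_all_iff.2 fun a => ae_all_iff.2 (h2 a)] with ω h3 h4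
  refine tendsto_pi_nhds.2 fun a => tendsto_pi_nhds.2 fun b => ?_
  have h5 : covX P a b = ∫ w : Obs h p, w.2 a * w.2 b ∂P -
      (∫ w : Obs h p, w.2 a ∂P) * ∫ w : Obs h p, w.2 b ∂P :=
    covariance_eq_sub ((memLp_coord hmom a).mono_exponent (by norm_num))
      ((memLp_coord hmom b).mono_exponent (by norm_num))
  rw [h5]
  refine ((h4 a b).sub ((h3 a).mul (h3 b))).congr' ?_
  filter_upwards [eventually_ne_atTop 0] with n hn
  rw [covHat_eq_avg hn]

theorem tendsto_meanHat_sub {h p : ℕ} {P : Measure (Obs h p)} [IsProbabilityMeasure P]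
    (hmom : MemLp (fun w : Obs h p => w.2) 4 P) {Ω : Type*} [MeasurableSpace Ω]
    {ν : Measure Ω} {D : ℕ → Ω → Obs h p} (hlaw : ∀ i, HasLaw (D i) P ν)
    (hindep : iIndepFun D ν) (a : Fin p) :
    ∀ᵐ ω ∂ν, Tendsto (fun n : ℕ => meanHat (fun i : Fin n => D i ω) a - meanX P a) atTop
      (𝓝 0) := by
  filter_upwards [tendsto_avg hlaw hindep (F := fun w => w.2 a) (by fun_prop)
    ((memLp_coord hmom a).integrable (by norm_num))] with ω hω
  rw [← sub_self (meanX P a)]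
  refine Tendsto.sub_const ?_ _
  rw [meanX_apply hmom]
  exact hω.congr fun n => (meanHat_apply _ a).symm

theorem tendsto_fHat {h p : ℕ} {P : Measure (Obs h p)} [IsProbabilityMeasure P]
    {Ω : Type*} [MeasurableSpace Ω]
    {ν : Measure Ω} {D : ℕ → Ω → Obs h p} (hlaw : ∀ i, HasLaw (D i) P ν)
    (hindep : iIndepFun D ν) (y : Fin h) :
    ∀ᵐ ω ∂ν, Tendsto (fun n : ℕ => fHat (fun i : Fin n => D i ω) y) atTop (𝓝 (f P y)) := by
  filter_upwards [tendsto_avg hlaw hindep (measurable_J y) ((memLp_J P y 1).integrable le_rfl)]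
    with ω hω
  rw [← integral_J]
  exact hω.congr fun n => (fHat_eq_avg _ y).symm

theorem measurable_avg {h p n : ℕ} {F : Obs h p → ℝ} (hF : Measurable F) :
    Measurable fun d : Fin n → Obs h p => avg d F := by
  unfold avg
  exact (Finset.measurable_fun_sum _ fun i _ => hF.comp (measurable_pi_apply i)).const_mul _

theorem measurable_covHat_apply {h p n : ℕ} (a b : Fin p) :
    Measurable fun d : Fin n → Obs h p => covHat d a b := by
  rcases eq_or_ne n 0 with rfl | hn
  · exact Subsingleton.measurable
  simp only [covHat_eq_avg hn]
  exact (measurable_avg (by fun_prop)).sub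
    ((measurable_avg (by fun_prop)).mul (measurable_avg (by fun_prop)))

/-! ### The limit law of the test statistic -/

/-- The vector with entries `ε_y` and `(X - E X)_i ε_y`. -/
def scoreVec {h p : ℕ} (P : Measure (Obs h p)) (w : Obs h p) :
    EuclideanSpace ℝ (Fin h × Option (Fin p)) :=
  WithLp.toLp 2 fun a => a.2.elim 1 (fun i => w.2 i - meanX P i) * eps P w a.1

theorem measurable_scoreVec {h p : ℕ} (P : Measure (Obs h p)) : Measurable (scoreVec P) := by
  refine (WithLp.measurable_toLp 2 _).comp (measurable_pi_iff.2 ?_)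
  rintro ⟨y, _ | i⟩
  · exact measurable_const.mul (measurable_eps P y)
  · have h1 : Measurable fun w : Obs h p => w.2 i - meanX P i := by fun_prop
    exact h1.mul (measurable_eps P y)

theorem memLp_scoreVec {h p : ℕ} {P : Measure (Obs h p)} [IsProbabilityMeasure P]
    (hmom : MemLp (fun w : Obs h p => w.2) 4 P) : MemLp (scoreVec P) 2 P := by
  refine MemLp.of_eval_piLp ?_
  rintro ⟨y, _ | i⟩
  · exact memLp_mul_two (memLp_const 1) (memLp_eps hmom y)
  · exact memLp_mul_two (memLp_coord_sub hmom i) (memLp_eps hmom y)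

theorem integral_inner_scoreVec {h p : ℕ} {P : Measure (Obs h p)} [IsProbabilityMeasure P]
    (hmom : MemLp (fun w : Obs h p => w.2) 4 P) (hcov : (covX P).PosDef)
    (t : EuclideanSpace ℝ (Fin h × Option (Fin p))) :
    ∫ w, inner ℝ (scoreVec P w) t ∂P = 0 := by
  simp only [PiLp.inner_apply]
  have hint : ∀ a, Integrable (fun w => inner ℝ (scoreVec P w a) (t a)) P := fun a =>
    (((memLp_scoreVec hmom).eval_piLp a).integrable (by norm_num)).inner_const (t a)
  rw [integral_finsetSum _ fun a _ => hint a]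
  refine Finset.sum_eq_zero ?_
  rintro ⟨y, o⟩ -
  have h1 : ∫ w, scoreVec P w (y, o) ∂P = 0 := by
    rcases o with _ | i
    · simpa [scoreVec] using integral_eps hmom y
    · exact integral_coord_sub_mul_eps hmom hcov y i
  simp only [RCLike.inner_apply, conj_trivial]
  rw [integral_const_mul, h1, mul_zero]

/-- The test statistic as a function of the normalized sum of the scores and of the consistent
estimators. -/
def limitForm {h p : ℕ} (x : EuclideanSpace ℝ (Fin h × Option (Fin p)) ×
    ((Fin p → Fin p → ℝ) × (Fin h → ℝ) × (Fin p → ℝ))) : ℝ :=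
  ∑ y, x.2.2.1 y * ∑ a, ∑ b, x.2.1 a b *
    (x.1 (y, some a) - x.2.2.2 a * x.1 (y, none)) * (x.1 (y, some b) - x.2.2.2 b * x.1 (y, none))

theorem continuous_limitForm {h p : ℕ} : Continuous (limitForm (h := h) (p := p)) := by
  unfold limitForm
  fun_prop

/-- `α_xᵀ Σ⁻¹` normalized, so that `αᵀ Z = (scoreFactor) (X - E X)`. -/
def scoreFactor {p r : ℕ} (S : Matrix (Fin p) (Fin p) ℝ) (αx : Matrix (Fin p) (Fin r) ℝ) :
    Matrix (Fin r) (Fin p) ℝ :=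
  (orthBasis S αx)ᵀ * invSqrt S

/-- This factorization of `K(Σ)` turns the limiting quadratic form into a squared norm. -/
theorem scoreFactor_transpose_mul_self {p r : ℕ} {S : Matrix (Fin p) (Fin p) ℝ} (hS : S.PosDef)
    {αx : Matrix (Fin p) (Fin r) ℝ} (hαx : LinearIndependent ℝ αx.col) :
    (scoreFactor S αx)ᵀ * scoreFactor S αx = coefForm αx S := by
  have hG := posDef_transpose_mul_inv_mul hS hαx
  have hR := invSqrt_mul_self hS.posSemidef
  have h1 : scoreFactor S αx = invSqrt (αxᵀ * S⁻¹ * αx) * (αxᵀ * S⁻¹) := by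
    rw [scoreFactor, orthBasis, Matrix.transpose_mul, Matrix.transpose_mul, transpose_invSqrt,
      transpose_invSqrt]
    conv_rhs => rw [← hR]
    simp only [Matrix.mul_assoc, ← hR]
  have hSt : (S⁻¹)ᵀ = S⁻¹ := by
    rw [← hR, Matrix.transpose_mul, transpose_invSqrt]
  rw [h1, Matrix.transpose_mul, Matrix.transpose_mul, transpose_invSqrt, hSt,
    Matrix.transpose_transpose, coefForm, ← invSqrt_mul_self hG.posSemidef]
  simp only [Matrix.mul_assoc]

theorem alphaZ_eq {h p r : ℕ} (P : Measure (Obs h p)) (αx : Matrix (Fin p) (Fin r) ℝ)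
    (w : Obs h p) : alphaZ P αx w = scoreFactor (covX P) αx *ᵥ (w.2 - meanX P).ofLp := by
  rw [alphaZ, Z_ofLp, scoreFactor, Matrix.mulVec_mulVec]

/-- The linear map taking the scores to `D_g⁻¹ ε ⊗ αᵀ Z`. -/
def scoreMap {h p r : ℕ} (P : Measure (Obs h p)) (αx : Matrix (Fin p) (Fin r) ℝ)
    (x : EuclideanSpace ℝ (Fin h × Option (Fin p))) : EuclideanSpace ℝ (Fin h × Fin r) :=
  WithLp.toLp 2 fun a =>
    (g P a.1)⁻¹ * ∑ i, scoreFactor (covX P) αx a.2 i * x (a.1, some i)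

theorem measurable_scoreMap {h p r : ℕ} (P : Measure (Obs h p)) (αx : Matrix (Fin p) (Fin r) ℝ) :
    Measurable (scoreMap P αx) := by
  unfold scoreMap
  fun_prop

theorem scoreMap_scoreVec {h p r : ℕ} (P : Measure (Obs h p)) (αx : Matrix (Fin p) (Fin r) ℝ)
    (w : Obs h p) : scoreMap P αx (scoreVec P w) = WithLp.toLp 2 (residVec P αx w) := by
  ext ⟨y, k⟩
  simp only [scoreMap, scoreVec, residVec, alphaZ_eq, Matrix.mulVec, dotProduct, Option.elim,
    Finset.mul_sum]
  exact Finset.sum_congr rfl fun i _ => by simp; ring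

/-- In the limit the error `X̄ - E X` is `0`, so the `none` coordinates (those of `ε_y`) drop out.
-/
theorem norm_scoreMap_sq {h p r : ℕ} {P : Measure (Obs h p)} (hcov : (covX P).PosDef)
    {αx : Matrix (Fin p) (Fin r) ℝ} (hαx : LinearIndependent ℝ αx.col)
    (x : EuclideanSpace ℝ (Fin h × Option (Fin p))) :
    limitForm (x, (coefForm αx (covX P), (fun y => (f P y)⁻¹), 0)) = ‖scoreMap P αx x‖ ^ 2 := by
  rw [EuclideanSpace.real_norm_sq_eq, Fintype.sum_prod_type]
  simp only [limitForm]
  refine Finset.sum_congr rfl fun y _ => ?_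
  simp only [scoreMap, mul_pow, ← Finset.mul_sum, Pi.zero_apply, zero_mul, sub_zero]
  rw [← g_mul_self, mul_inv, ← sq]
  congr 1
  simp only [← scoreFactor_transpose_mul_self hcov hαx, Matrix.mul_apply, Matrix.transpose_apply,
    sq, Finset.sum_mul]
  simp only [Finset.mul_sum]
  rw [Finset.sum_comm (s := (Finset.univ : Finset (Fin r)))]
  refine Finset.sum_congr rfl fun a _ => ?_
  rw [Finset.sum_comm (s := (Finset.univ : Finset (Fin r)))]
  exact Finset.sum_congr rfl fun b _ => Finset.sum_congr rfl fun k _ => by ring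

theorem charFun_map_scoreMap {h p r : ℕ} {P : Measure (Obs h p)} [IsProbabilityMeasure P]
    (hmom : MemLp (fun w : Obs h p => w.2) 4 P) (hcov : (covX P).PosDef)
    (hf : ∀ y, 0 < f P y) (hcs : CentralSubspaceExists P)
    {αx : Matrix (Fin p) (Fin r) ℝ} (hαx : LinearIndependent ℝ αx.col)
    (hH : CoordinateHypothesis P αx) (hlin : Linearity P) (hcover : Coverage P)
    (hconst : ConstantCovariance P)
    {Q : Measure (EuclideanSpace ℝ (Fin h × Option (Fin p)))}
    (hQ : ∀ t, charFun Q t =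
      Complex.exp (-(((∫ w, inner ℝ (scoreVec P w) t ^ 2 ∂P) / 2 : ℝ) : ℂ)))
    (t : EuclideanSpace ℝ (Fin h × Fin r)) :
    charFun (Q.map (scoreMap P αx)) t =
      Complex.exp (-(((∑ k, (fun y => t (y, k)) ⬝ᵥ Delta P *ᵥ fun y => t (y, k)) / 2 : ℝ) : ℂ)) := by
  -- The adjoint of `scoreMap` applied to `t`.
  let s : EuclideanSpace ℝ (Fin h × Option (Fin p)) := WithLp.toLp 2 fun a =>
    a.2.elim 0 fun i => (g P a.1)⁻¹ * ∑ k, scoreFactor (covX P) αx k i * t (a.1, k)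
  have hs : ∀ x, inner ℝ (scoreMap P αx x) t = inner ℝ x s := fun x => by
    simp only [PiLp.inner_apply, RCLike.inner_apply, conj_trivial, Fintype.sum_prod_type,
      Fintype.sum_option, s, scoreMap, Option.elim, zero_mul, zero_add, Finset.mul_sum,
      Finset.sum_mul]
    refine Finset.sum_congr rfl fun y _ => ?_
    rw [Finset.sum_comm]
    exact Finset.sum_congr rfl fun i _ => Finset.sum_congr rfl fun k _ => by ring
  have h1 : charFun (Q.map (scoreMap P αx)) t = charFun Q s := by
    rw [charFun_apply, charFun_apply,
      integral_map (measurable_scoreMap P αx).aemeasurable (by fun_prop)]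
    simp_rw [hs]
  rw [h1, hQ]
  simp_rw [← hs, scoreMap_scoreVec]
  rw [← integral_sum_residVec_sq hmom hcov hf hcs hαx hH hlin hcover hconst fun a => t a]
  simp only [PiLp.inner_apply, RCLike.inner_apply, conj_trivial, mul_comm]

/-- Only the law of the limit matters, so it can be carried from the Gaussian space to the product
of chi-squared laws. -/
theorem tendstoInDistribution_of_map_eq {E Ω Ω' Ω'' : Type*} [TopologicalSpace E]
    [MeasurableSpace E] [OpensMeasurableSpace E] [MeasurableSpace Ω] [MeasurableSpace Ω']
    [MeasurableSpace Ω''] {ν : Measure Ω} [IsProbabilityMeasure ν] {μ : Measure Ω'}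
    [IsProbabilityMeasure μ] {μ' : Measure Ω''} [IsProbabilityMeasure μ'] {T : ℕ → Ω → E}
    {U : Ω' → E} {W : Ω'' → E} (hT : TendstoInDistribution T atTop U (fun _ => ν) μ)
    (hW : AEMeasurable W μ') (hUW : μ.map U = μ'.map W) :
    TendstoInDistribution T atTop W (fun _ => ν) μ' := by
  refine ⟨hT.forall_aemeasurable, hW, ?_⟩
  have h1 : (⟨μ'.map W, Measure.isProbabilityMeasure_map hW⟩ : ProbabilityMeasure E) =
      ⟨μ.map U, Measure.isProbabilityMeasure_map hT.aemeasurable_limit⟩ := Subtype.ext hUW.symm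
  rw [h1]
  exact hT.tendsto

theorem testStat_eq_limitForm {h p r : ℕ} (P : Measure (Obs h p))
    {αx : Matrix (Fin p) (Fin r) ℝ} (hαx : LinearIndependent ℝ αx.col)
    (hβ : ∀ y, αxᵀ *ᵥ beta P y = 0) (D : ℕ → Obs h p) (n : ℕ) :
    testStat αx (fun i : Fin n => D i) =
      limitForm ((√n)⁻¹ • ∑ k ∈ Finset.range n, scoreVec P (D k),
        (coefForm αx (covHat fun i : Fin n => D i), fun y => (fHat (fun i : Fin n => D i) y)⁻¹,
          fun a => meanHat (fun i : Fin n => D i) a - meanX P a)) := by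
  -- `√n / n = 1 / √n`, valid also for `n = 0`.
  have havg : ∀ F : Obs h p → ℝ, √(n : ℝ) * avg (fun i : Fin n => D i) F =
      (√(n : ℝ))⁻¹ * ∑ k ∈ Finset.range n, F (D k) := fun F => by
    rw [avg, Fin.sum_univ_eq_sum_range (fun k => F (D k)) n, ← mul_assoc, ← div_eq_mul_inv,
      Real.sqrt_div_self]
  have hx : ∀ a, ((√(n : ℝ))⁻¹ • ∑ k ∈ Finset.range n, scoreVec P (D k)) a =
      (√(n : ℝ))⁻¹ * ∑ k ∈ Finset.range n, scoreVec P (D k) a := fun a => by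
    simp
  rw [testStat_eq_sum_resid P αx hαx hβ]
  simp only [limitForm, havg, hx]
  simp [scoreVec]

theorem tendstoInDistribution_testStat {h p r : ℕ} {P : Measure (Obs h p)}
    [IsProbabilityMeasure P]
    (hmom : MemLp (fun w : Obs h p => w.2) 4 P) (hcov : (covX P).PosDef)
    (hf : ∀ y, 0 < f P y) (hcs : CentralSubspaceExists P)
    {αx : Matrix (Fin p) (Fin r) ℝ} (hαx : LinearIndependent ℝ αx.col)
    (hH : CoordinateHypothesis P αx) (hlin : Linearity P) (hcover : Coverage P)
    (hconst : ConstantCovariance P) {Ω : Type*} [MeasurableSpace Ω] {ν : Measure Ω}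
    [IsProbabilityMeasure ν] {D : ℕ → Ω → Obs h p} (hlaw : ∀ i, HasLaw (D i) P ν)
    (hindep : iIndepFun D ν) :
    TendstoInDistribution
      (fun (n : ℕ) (ω : Ω) => testStat αx fun i : Fin n => D i ω) atTop
      (fun c : Fin (h - 1) → ℝ => ∑ j, delta P (Fin.castLE (Nat.sub_le h 1) j) * c j)
      (fun _ => ν) (Measure.pi fun _ : Fin (h - 1) => chiSquared r) := by
  have hβ := transpose_mulVec_beta hmom hcov hf hαx hH hcover
  have hpsd := posSemidef_Delta hmom hcov hf
  obtain ⟨Q, hQp, hQ⟩ := exists_charFun_eq_of_memLp_two (memLp_scoreVec hmom)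
  have hV0 : MemLp (fun ω => scoreVec P (D 0 ω)) 2 ν := by
    refine (memLp_map_measure_iff (measurable_scoreVec P).aestronglyMeasurable
      (hlaw 0).aemeasurable).1 ?_
    rw [(hlaw 0).map_eq]
    exact memLp_scoreVec hmom
  have hclt := tendstoInDistribution_inv_sqrt_smul_sum (ν := ν)
    (V := fun k ω => scoreVec P (D k ω)) (hindep.comp (fun _ => scoreVec P)
      fun _ => measurable_scoreVec P)
    (fun i => ((hlaw i).identDistrib (hlaw 0)).comp (measurable_scoreVec P)) hV0
    (fun t => by
      have hm : Measurable fun w => inner ℝ (scoreVec P w) t :=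
        (measurable_scoreVec P).inner measurable_const
      rw [← integral_inner_scoreVec hmom hcov t]
      exact (hlaw 0).integral_comp hm.aestronglyMeasurable) Q
    (fun t => by
      have hm : Measurable fun w => inner ℝ (scoreVec P w) t ^ 2 :=
        ((measurable_scoreVec P).inner measurable_const).pow_const 2
      rw [hQ, ← (hlaw 0).integral_comp hm.aestronglyMeasurable]
      rfl)
  let Y : ℕ → Ω → (Fin p → Fin p → ℝ) × (Fin h → ℝ) × (Fin p → ℝ) := fun n ω =>
    (coefForm αx (covHat fun i : Fin n => D i ω), fun y => (fHat (fun i : Fin n => D i ω) y)⁻¹,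
      fun a => meanHat (fun i : Fin n => D i ω) a - meanX P a)
  let c : (Fin p → Fin p → ℝ) × (Fin h → ℝ) × (Fin p → ℝ) :=
    (coefForm αx (covX P), (fun y => (f P y)⁻¹), 0)
  have hYm : ∀ n, AEMeasurable (Y n) ν := fun n => by
    have h1 : AEMeasurable (fun ω => fun i : Fin n => D i ω) ν :=
      aemeasurable_pi_lambda _ fun i => (hlaw i).aemeasurable
    have h2 : Measurable fun d : Fin n → Obs h p =>
        ((coefForm αx (covHat d), fun y => (fHat d y)⁻¹, fun a => meanHat d a - meanX P a) :
          (Fin p → Fin p → ℝ) × (Fin h → ℝ) × (Fin p → ℝ)) := by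
      refine Measurable.prodMk ?_ (Measurable.prodMk ?_ ?_)
      · exact measurable_pi_iff.2 fun a => measurable_pi_iff.2 fun b =>
          measurable_coefForm_apply αx measurable_covHat_apply a b
      · refine measurable_pi_iff.2 fun y => Measurable.inv ?_
        simp only [fHat_eq_avg]
        exact measurable_avg (measurable_J y)
      · refine measurable_pi_iff.2 fun a => Measurable.sub_const ?_ _
        simp only [meanHat_apply]
        exact measurable_avg (by fun_prop)
    exact h2.comp_aemeasurable h1
  have hYc : ∀ᵐ ω ∂ν, Tendsto (fun n => Y n ω) atTop (𝓝 c) := by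
    filter_upwards [tendsto_covHat hmom hlaw hindep,
      ae_all_iff.2 (tendsto_fHat (P := P) hlaw hindep),
      ae_all_iff.2 (tendsto_meanHat_sub hmom hlaw hindep)] with ω h1 h2 h3
    refine Tendsto.prodMk_nhds (tendsto_coefForm hαx h1 hcov)
      (Tendsto.prodMk_nhds ?_ (tendsto_pi_nhds.2 h3))
    exact tendsto_pi_nhds.2 fun y => (h2 y).inv₀ (hf y).ne'
  -- Slutsky and continuous mapping: the scores converge in law and the estimators to a constant, so
  -- no joint limit law is needed.
  have hmain := hclt.continuous_comp_prodMk_of_tendstoInMeasure_const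
    (continuous_limitForm (h := h) (p := p))
    (tendstoInMeasure_of_tendsto_ae (fun n => (hYm n).aestronglyMeasurable) hYc) hYm
  have hstat : (fun (n : ℕ) (ω : Ω) => testStat αx fun i : Fin n => D i ω) = fun (n : ℕ) ω =>
      limitForm ((√n)⁻¹ • ∑ k ∈ Finset.range n, scoreVec P (D k ω), Y n ω) := by
    ext n ω
    exact testStat_eq_limitForm P hαx hβ (fun k => D k ω) n
  rw [hstat]
  refine tendstoInDistribution_of_map_eq hmain (Measurable.aemeasurable (by fun_prop)) ?_
  have : IsProbabilityMeasure (Q.map (scoreMap P αx)) :=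
    Measure.isProbabilityMeasure_map (measurable_scoreMap P αx).aemeasurable
  rw [← map_norm_sq_eq_map_delta hpsd
    (fun j hj => delta_last_eq_zero hpsd g_ne_zero (Delta_mulVec_g hmom hf) j hj)
    (Q.map (scoreMap P αx))
    (charFun_map_scoreMap hmom hcov hf hcs hαx hH hlin hcover hconst hQ),
    Measure.map_map (by fun_prop) (measurable_scoreMap P αx)]
  congr 1
  ext x
  exact norm_scoreMap_sq hcov hαx x

end SIR

end

theorem corollary1 {h p r : ℕ}
    -- the joint law of `(Y, X)`: finite fourth moments, nonsingular covariance, nonempty slices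
    (P : Measure (SIR.Obs h p)) [IsProbabilityMeasure P]
    (hmom : MemLp (fun w : SIR.Obs h p => w.2) 4 P)
    (hcov : (SIR.covX P).PosDef)
    (hf : ∀ y : Fin h, 0 < SIR.f P y)
    (hcs : SIR.CentralSubspaceExists P)
    -- the coordinate hypothesis, specified by a `p × r` matrix of full column rank
    (αx : Matrix (Fin p) (Fin r) ℝ) (hαx : LinearIndependent ℝ αx.col)
    (hH : SIR.CoordinateHypothesis P αx)
    (hlin : SIR.Linearity P) (hcover : SIR.Coverage P) (hconst : SIR.ConstantCovariance P)
    -- the i.i.d. observations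
    {Ω : Type*} [MeasurableSpace Ω] (ν : Measure Ω) [IsProbabilityMeasure ν]
    (D : ℕ → Ω → SIR.Obs h p)
    (hlaw : ∀ i, HasLaw (D i) P ν) (hindep : iIndepFun D ν) :
    SIR.Omega P αx =
        (SIR.Qg P - (SIR.muMatrix P)ᵀ * SIR.muMatrix P) ⊗ₖ (1 : Matrix (Fin r) (Fin r) ℝ) ∧
      Antitone (SIR.delta P) ∧
      (∀ j : Fin h, (j : ℕ) + 1 = h → SIR.delta P j = 0) ∧
      TendstoInDistribution
        (fun (n : ℕ) (ω : Ω) => SIR.testStat αx fun i : Fin n => D i ω) atTop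
        (fun c : Fin (h - 1) → ℝ => ∑ j, SIR.delta P (Fin.castLE (Nat.sub_le h 1) j) * c j)
        (fun _ => ν) (Measure.pi fun _ : Fin (h - 1) => SIR.chiSquared r) :=
  ⟨SIR.Omega_eq hmom hcov hf hcs hαx hH hlin hcover hconst, SIR.antitone_delta P,
    fun j hj => SIR.delta_last_eq_zero (SIR.posSemidef_Delta hmom hcov hf) SIR.g_ne_zero
      (SIR.Delta_mulVec_g hmom hf) j hj,
    SIR.tendstoInDistribution_testStat hmom hcov hf hcs hαx hH hlin hcover hconst hlaw hindep⟩
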